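/- Let $n\ge 1$. For a convex body $K\subset\mathbb{R}^n$ (compact, convex) with the origin in its interior let $N(x)$ be an outer unit normal of $K$ at $x\in\partial K$, let $k_1(x),\dots,k_{n-1}(x)$ be the (generalized) principal curvatures of $\partial K$ at $x$, which exist for almost every $x\in\partial K$ by the theorem of Alexandrov and Busemann--Feller, and put $H_0=1$ and $$H_j=\binom{n-1}{j}^{-1}\sum_{1\le i_1<\dots<i_j\le n-1}k_{i_1}\cdots k_{i_j}\qquad(1\le j\le n-1).$$ For $\alpha\in\mathbb{R}$ and an integer $q\ge 0$ let $\binom{\alpha}{q}=\frac{\alpha(\alpha-1)\cdots(\alpha-q+1)}{q!}$. For $p\in\mathbb{R}$, $p\ne -n$, and integers $m,k\ge 0$ the $L_p$ Steiner coefficients of $K$ are $$\mathcal{W}^p_{m,k}(K)=\int_{\partial K}\langle x,N(x)\rangle^{m-k+\frac{n(1-p)}{n+p}}\,H_{n-1}(x)^{\frac{p}{n+p}}\sum_{\substack{i_1,\dots,i_{n-1}\ge 0\\ i_1+2i_2+\dots+(n-1)i_{n-1}=m}}c(n,p,i)\prod_{j=1}^{n-1}\binom{n-1}{j}^{i_j}H_j(x)^{i_j}\,d\mathcal{H}^{n-1}(x),$$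 where $$c(n,p,i)=\binom{\frac{n}{n+p}}{i_1+\dots+i_{n-1}}\,\frac{(i_1+\dots+i_{n-1})!}{i_1!\cdots i_{n-1}!},$$ and the $L_p$-Steiner quermassintegrals of $K$ are $$\mathcal{V}^p_k(K)=\sum_{m=0}^{k}\binom{\frac{n(1-p)}{n+p}}{k-m}\,\mathcal{W}^p_{m,k}(K).$$ Let $\mathcal{C}^n$ be the class of all convex bodies $K\subset\mathbb{R}^n$ with the origin in the interior that admit an inner and an outer rolling ball, that is, for which there are $r,R>0$ such that, for every $x\in\partial K$ and every outer unit normal $N(x)$ of $K$ at $x$, $$B(x-rN(x),r)\subseteq K\subseteq B(x-RN(x),R),$$ where $B(y,s)$ is the closed Euclidean ball with centre $y$ and radius $s$. Theorem. Let $p\ge 0$ or $p<-n$, and let $m,k\ge 0$ be integers. Then $\mathcal{W}^p_{m,k}$ and $\mathcal{V}^p_k$ are valuations on $\mathcal{C}^n$: for all $K,L\in\mathcal{C}^n$ with $K\cup L\in\mathcal{C}^n$, the integrals that define these quantities converge absolutely for $K$, $L$, $K\cup L$ and $K\cap L$, and $$\varphi(K\cup L)+\varphi(K\cap L)=\varphi(K)+\varphi(L)\qquad\text{for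 }\varphi=\mathcal{W}^p_{m,k}\text{ and for }\varphi=\mathcal{V}^p_k.$$ In particular (the case $p=1$, $m=k$) the functionals $\mathcal{W}_{k,k}=\mathcal{W}^1_{k,k}$ are valuations on $\mathcal{C}^n$. -/

import Mathlib

open MeasureTheory Asymptotics Topology
open scoped RealInnerProductSpace

noncomputable section

namespace LpSteiner

/-- `u` is an outer unit normal of `K` at `x`. -/
def IsOuterNormal {n : ℕ} (K : Set (EuclideanSpace ℝ (Fin n))) (x u : EuclideanSpace ℝ (Fin n)) :
    Prop :=
  ‖u‖ = 1 ∧ ∀ y ∈ K, ⟪y - x, u⟫ ≤ 0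

open Classical in
/-- The outer unit normal `N(x)` of `K` at `x`.  For a convex body it exists at every boundary
point and is unique at almost every one; where it is not unique, one of them is selected. -/
def outerNormal {n : ℕ} (K : Set (EuclideanSpace ℝ (Fin n))) (x : EuclideanSpace ℝ (Fin n)) :
    EuclideanSpace ℝ (Fin n) :=
  if h : ∃ u, IsOuterNormal K x u then h.choose else 0

/-- `K` is a convex body that contains the origin in its interior. -/
structure IsConvexBodyO {n : ℕ} (K : Set (EuclideanSpace ℝ (Fin n))) : Prop where
  isConvex : Convex ℝ K
  isCompact : IsCompact K
  zero_mem : (0 : EuclideanSpace ℝ (Fin n)) ∈ interior K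

/-- `K` admits an inner rolling ball of some radius `r > 0`. -/
def HasInnerRollingBall {n : ℕ} (K : Set (EuclideanSpace ℝ (Fin n))) : Prop :=
  ∃ r : ℝ, 0 < r ∧ ∀ x ∈ frontier K, ∀ u, IsOuterNormal K x u →
    Metric.closedBall (x - r • u) r ⊆ K

/-- `K` admits an outer rolling ball of some radius `R > 0`. -/
def HasOuterRollingBall {n : ℕ} (K : Set (EuclideanSpace ℝ (Fin n))) : Prop :=
  ∃ R : ℝ, 0 < R ∧ ∀ x ∈ frontier K, ∀ u, IsOuterNormal K x u →
    K ⊆ Metric.closedBall (x - R • u) R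

/-- The class `𝒞ⁿ` of convex bodies in `ℝⁿ` with the origin in the interior that admit an inner
and an outer rolling ball. -/
def rollingClass (n : ℕ) : Set (Set (EuclideanSpace ℝ (Fin n))) :=
  {K | IsConvexBodyO K ∧ HasInnerRollingBall K ∧ HasOuterRollingBall K}

/-- `A` is the generalized Weingarten map of `K` at the boundary point `x`, in the sense of
Alexandrov and Busemann-Feller.  If `∂K` is written near `x` as `x + v - f(v) N(x)` with `v` in the
tangent hyperplane `N(x)ᗮ`, then `expansion` says `f(v) = ⟪A v, v⟫ / 2 + o(‖v‖²)`.  The map `A` is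
the self-adjoint operator on the tangent hyperplane, extended by `0` in the normal direction. -/
structure IsWeingartenMap {n : ℕ} (K : Set (EuclideanSpace ℝ (Fin n)))
    (x : EuclideanSpace ℝ (Fin n))
    (A : EuclideanSpace ℝ (Fin n) →ₗ[ℝ] EuclideanSpace ℝ (Fin n)) : Prop where
  symmetric : A.IsSymmetric
  normal : A (outerNormal K x) = 0
  expansion :
    (fun y => ⟪x - y, outerNormal K x⟫ - (1 / 2 : ℝ) * ⟪A (y - x), y - x⟫)
      =o[𝓝[frontier K] x] (fun y => ‖y - x‖ ^ 2)

open Classical in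
/-- The generalized Weingarten map; it exists at almost every boundary point of a convex body, and
is set to `0` where it does not exist. -/
def weingartenMap {n : ℕ} (K : Set (EuclideanSpace ℝ (Fin n))) (x : EuclideanSpace ℝ (Fin n)) :
    EuclideanSpace ℝ (Fin n) →ₗ[ℝ] EuclideanSpace ℝ (Fin n) :=
  if h : ∃ A, IsWeingartenMap K x A then h.choose else 0

/-- The `n - 1` principal curvatures of `K` at `x`, with multiplicity: the eigenvalues of the
Weingarten map on the tangent hyperplane.  (One eigenvalue `0`, which belongs to the normal
direction, is removed.) -/
def principalCurvatures {n : ℕ} (K : Set (EuclideanSpace ℝ (Fin n)))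
    (x : EuclideanSpace ℝ (Fin n)) : Multiset ℝ :=
  (weingartenMap K x).charpoly.roots.erase 0

/-- The `j`-th normalized elementary symmetric function `H_j` of the principal curvatures. -/
def curvatureH {n : ℕ} (K : Set (EuclideanSpace ℝ (Fin n))) (j : ℕ)
    (x : EuclideanSpace ℝ (Fin n)) : ℝ :=
  ((n - 1).choose j : ℝ)⁻¹ * (principalCurvatures K x).esymm j

/-- The sequences `i₁, …, i_{n-1} ≥ 0` with `i₁ + 2 i₂ + ⋯ + (n - 1) i_{n-1} = m`; the entry
`i_{j+1}` is `i j`. -/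
def indexSet (n m : ℕ) : Finset (Fin (n - 1) → ℕ) :=
  (Fintype.piFinset fun _ => Finset.range (m + 1)).filter
    fun i => ∑ j : Fin (n - 1), ((j : ℕ) + 1) * i j = m

theorem mem_indexSet {n m : ℕ} (i : Fin (n - 1) → ℕ) :
    i ∈ indexSet n m ↔ ∑ j : Fin (n - 1), ((j : ℕ) + 1) * i j = m := by
  simp only [indexSet, Finset.mem_filter, Fintype.mem_piFinset, Finset.mem_range,
    and_iff_right_iff_imp]
  intro h j
  have h1 : ((j : ℕ) + 1) * i j ≤ ∑ j : Fin (n - 1), ((j : ℕ) + 1) * i j :=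
    Finset.single_le_sum (f := fun j : Fin (n - 1) => ((j : ℕ) + 1) * i j)
      (fun _ _ => Nat.zero_le _) (Finset.mem_univ j)
  nlinarith [Nat.zero_le ((j : ℕ) * i j)]

/-- The coefficient `c(n, p, i)`: a generalized binomial coefficient times a multinomial one. -/
def coeffC (n : ℕ) (p : ℝ) (i : Fin (n - 1) → ℕ) : ℝ :=
  Ring.choose ((n : ℝ) / (n + p)) (∑ j, i j) * (Nat.multinomial Finset.univ i : ℝ)

/-- The integrand of the `L_p` Steiner coefficient `𝒲^p_{m,k}`. -/
def steinerIntegrand {n : ℕ} (p : ℝ) (m k : ℕ) (K : Set (EuclideanSpace ℝ (Fin n)))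
    (x : EuclideanSpace ℝ (Fin n)) : ℝ :=
  ⟪x, outerNormal K x⟫ ^ ((m : ℝ) - k + n * (1 - p) / (n + p)) *
    curvatureH K (n - 1) x ^ (p / (n + p)) *
    ∑ i ∈ indexSet n m, coeffC n p i *
      ∏ j : Fin (n - 1),
        (((n - 1).choose ((j : ℕ) + 1) : ℝ) ^ i j * curvatureH K ((j : ℕ) + 1) x ^ i j)

/-- The `L_p` Steiner coefficient `𝒲^p_{m,k}(K)`. -/
def steinerW {n : ℕ} (p : ℝ) (m k : ℕ) (K : Set (EuclideanSpace ℝ (Fin n))) : ℝ :=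
  ∫ x in frontier K, steinerIntegrand p m k K x ∂μHE[n - 1]

/-- The `L_p`-Steiner quermassintegral `𝒱^p_k(K)`. -/
def steinerV {n : ℕ} (p : ℝ) (k : ℕ) (K : Set (EuclideanSpace ℝ (Fin n))) : ℝ :=
  ∑ m ∈ Finset.range (k + 1),
    Ring.choose ((n : ℝ) * (1 - p) / (n + p)) (k - m) * steinerW p m k K

/-- `φ` is a valuation on the class `S`. -/
def IsValuationOn {n : ℕ} (S : Set (Set (EuclideanSpace ℝ (Fin n))))
    (φ : Set (EuclideanSpace ℝ (Fin n)) → ℝ) : Prop :=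
  ∀ K ∈ S, ∀ L ∈ S, K ∪ L ∈ S → φ (K ∪ L) + φ (K ∩ L) = φ K + φ L

end LpSteiner

end

/-!
A valuation identity for integrals over the boundaries follows from a decomposition into pieces.
`∂K` consists of the part outside `L`, the part in the interior of `L`, and the common part
`E = ∂K ∩ ∂L`; similarly for `∂L`. The outside parts together with `E` make up `∂(K ∪ L)`, the inside
parts together with `E` make up `∂(K ∩ L)`. Off `E` the integrands agree because normal and
curvatures are local. So the point is to compare, almost everywhere on `E`, the curvatures of the
four bodies `K`, `L`, `K ∪ L` and `K ∩ L`.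

At a point of `E` the four bodies have the same outer normal and a common ball touching them from
inside (`exists_touchesInside_common`). Such balls make the normal a Lipschitz function of the point
and squeeze the boundary between the supporting hyperplane and a paraboloid. Hence, if `x ∈ E` and
every boundary point `y` near `x` is at distance `o(‖y - x‖)` from `E`, the second-order expansion of
the boundary at `x` only depends on `E` and the normals along `E`
(`isWeingartenMap_iff_of_isNonporousAt`). So the four bodies have the same generalized Weingarten map
at `x`, or none of them has one. Almost every point of `E` has this property (`ae_isNonporousAt`):
where the normals are close to a direction `u`, the projection along `u` is bi-Lipschitz, and it
would send a porous point to a point of a hyperplane that is not a Lebesgue density point of the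
image of `E`. In particular, the existence of the curvatures almost everywhere is not needed.

Integrability (`integrableOn_steinerIntegrand`) holds because the integrand is bounded and measurable
on a set of finite measure. Inner touching balls bound the Weingarten map and make it unique, and the
pairs of a point and its Weingarten map form a Borel set, so that the Weingarten map is a Borel
function by the Lusin-Souslin theorem. The functions `H_j` are coefficients of its characteristic
polynomial, hence continuous in it, and the exponent `p / (n + p)` of `H_{n-1}` is nonnegative for
`p ≥ 0` and for `p < -n`.
-/

noncomputable section

namespace LpSteiner

open Set Metric Filter

variable {n : ℕ}

local notation "𝔼" => EuclideanSpace ℝ (Fin n)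

/-! ### Outer normals and balls touching from inside -/

theorem inter_frontier_nonempty_of_isPreconnected {X : Type*} [TopologicalSpace X] {s t : Set X}
    (ht : IsPreconnected t) (h : (t ∩ s).Nonempty) (h' : (t ∩ sᶜ).Nonempty) :
    (t ∩ frontier s).Nonempty := by
  by_contra hf
  rw [not_nonempty_iff_eq_empty, ← disjoint_iff_inter_eq_empty, disjoint_left] at hf
  have hmem : ∀ y ∈ t, y ∈ interior s ∨ y ∈ (closure s)ᶜ := fun y hy => by
    by_contra hc
    push Not at hc
    exact hf hy ⟨not_notMem.1 hc.2, hc.1⟩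
  obtain ⟨a, hat, ha⟩ := h
  obtain ⟨b, hbt, hb⟩ := h'
  obtain ⟨y, -, hy, hy'⟩ := ht _ _ isOpen_interior isClosed_closure.isOpen_compl hmem
    ⟨a, hat, (hmem a hat).resolve_right fun h => h (subset_closure ha)⟩
    ⟨b, hbt, (hmem b hbt).resolve_left fun h => hb (interior_subset h)⟩
  exact hy' (subset_closure (interior_subset hy))

/-- The unit vector `u` is an outer normal of `M` at `x`, and the ball of radius `r > 0` that
touches the supporting hyperplane at `x` from inside is contained in `M`. -/
structure TouchesInside (M : Set 𝔼) (r : ℝ) (x u : 𝔼) : Prop where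
  pos : 0 < r
  normal : IsOuterNormal M x u
  ball : closedBall (x - r • u) r ⊆ M

theorem IsOuterNormal.mono {M M' : Set 𝔼} {x u : 𝔼} (h : IsOuterNormal M x u) (hM : M' ⊆ M) :
    IsOuterNormal M' x u :=
  ⟨h.1, fun y hy => h.2 y (hM hy)⟩

/-- A point at which a set has an outer normal is not an interior point. -/
theorem IsOuterNormal.notMem_interior {M : Set 𝔼} {x u : 𝔼} (h : IsOuterNormal M x u) :
    x ∉ interior M := by
  intro hx
  obtain ⟨ε, hε, hb⟩ := Metric.isOpen_iff.1 isOpen_interior x hx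
  have h1 : x + (ε / 2) • u ∈ M := by
    apply interior_subset
    apply hb
    rw [mem_ball, dist_eq_norm, add_sub_cancel_left, norm_smul, h.1,
      Real.norm_of_nonneg (by linarith)]
    linarith
  have h2 := h.2 _ h1
  rw [add_sub_cancel_left, inner_smul_left, real_inner_self_eq_norm_sq, h.1] at h2
  simp at h2
  linarith

theorem IsOuterNormal.le_inner_of_closedBall_subset {M : Set 𝔼} {x u : 𝔼} {ρ : ℝ}
    (h : IsOuterNormal M x u) (hρ : 0 ≤ ρ) (hb : closedBall 0 ρ ⊆ M) : ρ ≤ ⟪x, u⟫ := by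
  have h1 : ρ • u ∈ M := hb (by simp [norm_smul, h.1, abs_of_nonneg hρ])
  have h2 := h.2 _ h1
  rw [inner_sub_left, inner_smul_left, real_inner_self_eq_norm_sq, h.1] at h2
  simp at h2
  linarith

/-- A convex set with interior points has an outer normal at each of its boundary points. -/
theorem exists_isOuterNormal {M : Set 𝔼} (hc : Convex ℝ M) (hi : (interior M).Nonempty)
    {x : 𝔼} (hx : x ∈ frontier M) : ∃ u, IsOuterNormal M x u := by
  obtain ⟨f, hf⟩ := geometric_hahn_banach_open_point hc.interior isOpen_interior hx.2
  obtain ⟨w, hw⟩ := (InnerProductSpace.toDual ℝ 𝔼).surjective f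
  have hfw : ∀ a, f a = ⟪w, a⟫ := fun a => by rw [← hw]; simp
  have hw0 : w ≠ 0 := by
    rintro rfl
    obtain ⟨a, ha⟩ := hi
    have := hf a ha
    simp [hfw] at this
  refine ⟨‖w‖⁻¹ • w, by simp [norm_smul, hw0], fun y hy => ?_⟩
  have hcl : M ⊆ {a | f a ≤ f x} := by
    refine subset_closure.trans ?_
    rw [← hc.closure_interior_eq_closure_of_nonempty_interior hi]
    exact closure_minimal (fun a ha => (hf a ha).le) (isClosed_le f.continuous continuous_const)
  have := hcl hy
  simp only [mem_ofPred_eq, hfw] at this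
  rw [inner_smul_right, inner_sub_left, real_inner_comm, real_inner_comm w x]
  exact mul_nonpos_of_nonneg_of_nonpos (by positivity) (by linarith)

theorem isOuterNormal_outerNormal {M : Set 𝔼} {x : 𝔼} (h : ∃ u, IsOuterNormal M x u) :
    IsOuterNormal M x (outerNormal M x) := by
  rw [outerNormal, dif_pos h]
  exact h.choose_spec

/-- A ball inside `M` that touches the boundary at `x` forces the outer normals at nearby points
to be close to the one at `x`: test the support inequality at `y` with the point of the ball whose
normal is `v`. -/
theorem norm_sub_sq_le_of_closedBall_subset {M : Set 𝔼} {r : ℝ} {x y u v : 𝔼} (hr : 0 ≤ r)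
    (hu : ‖u‖ = 1) (hb : closedBall (x - r • u) r ⊆ M) (hv : IsOuterNormal M y v) :
    r / 2 * ‖u - v‖ ^ 2 ≤ ⟪y - x, v⟫ := by
  have h1 : x - r • u + r • v ∈ M := by
    refine hb ?_
    rw [mem_closedBall, dist_eq_norm, add_sub_cancel_left, norm_smul, hv.1, Real.norm_of_nonneg hr,
      mul_one]
  have h2 := hv.2 _ h1
  have h3 : x - r • u + r • v - y = r • v - r • u - (y - x) := by abel
  rw [h3, inner_sub_left, inner_sub_left, inner_smul_left, inner_smul_left,
    real_inner_self_eq_norm_sq, hv.1] at h2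
  rw [norm_sub_sq_real, hu, hv.1]
  simp at h2
  linarith

/-- Near a boundary point with an inner touching ball the boundary lies between the supporting
hyperplane and a paraboloid. -/
theorem inner_le_of_closedBall_subset {M : Set 𝔼} {r : ℝ} {x y u : 𝔼} (hr : 0 < r)
    (hu : ‖u‖ = 1) (hb : closedBall (x - r • u) r ⊆ M) (hy : y ∉ interior M) :
    ⟪x - y, u⟫ ≤ ‖y - x‖ ^ 2 / (2 * r) := by
  have h1 : y ∉ ball (x - r • u) r := fun h =>
    hy (interior_mono hb (ball_subset_interior_closedBall h))
  rw [mem_ball, dist_eq_norm, not_lt] at h1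
  have h2 : y - (x - r • u) = (y - x) + r • u := by abel
  have h3 : r ^ 2 ≤ ‖(y - x) + r • u‖ ^ 2 := by rw [← h2]; gcongr
  rw [norm_add_sq_real, inner_smul_right, norm_smul, hu, mul_one, Real.norm_of_nonneg hr.le] at h3
  rw [le_div_iff₀ (by positivity), ← neg_sub y x, inner_neg_left]
  linarith

namespace TouchesInside

variable {M : Set (EuclideanSpace ℝ (Fin n))} {r : ℝ} {x u : EuclideanSpace ℝ (Fin n)}

theorem mem (h : TouchesInside M r x u) : x ∈ M :=
  h.ball (by simp [norm_smul, h.normal.1, abs_of_pos h.pos])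

theorem mem_frontier (h : TouchesInside M r x u) : x ∈ frontier M :=
  ⟨subset_closure h.mem, h.normal.notMem_interior⟩

theorem mono_radius (h : TouchesInside M r x u) {s : ℝ} (hs : 0 < s) (hsr : s ≤ r) :
    TouchesInside M s x u := by
  refine ⟨hs, h.normal, (closedBall_subset_closedBall' ?_).trans h.ball⟩
  have : x - s • u - (x - r • u) = (r - s) • u := by rw [sub_smul]; abel
  rw [dist_eq_norm, this, norm_smul, h.normal.1, Real.norm_of_nonneg (by linarith)]
  linarith

/-- The outer normal at a point with an inner touching ball is unique. -/
theorem eq_of_isOuterNormal (h : TouchesInside M r x u) {v : 𝔼} (hv : IsOuterNormal M x v) :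
    v = u := by
  have h1 := norm_sub_sq_le_of_closedBall_subset h.pos.le h.normal.1 h.ball hv
  rw [sub_self, inner_zero_left] at h1
  have h2 : ‖u - v‖ ^ 2 ≤ 0 := by
    have := h.pos
    by_contra hc
    push Not at hc
    have : 0 < r / 2 * ‖u - v‖ ^ 2 := by positivity
    linarith
  have h3 : ‖u - v‖ = 0 := by
    have := sq_nonneg ‖u - v‖
    exact pow_eq_zero_iff two_ne_zero |>.1 (le_antisymm h2 this)
  exact (sub_eq_zero.1 (norm_eq_zero.1 h3)).symm

theorem outerNormal_eq (h : TouchesInside M r x u) : outerNormal M x = u :=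
  h.eq_of_isOuterNormal (isOuterNormal_outerNormal ⟨u, h.normal⟩)

theorem inner_nonneg (h : TouchesInside M r x u) {y : 𝔼} (hy : y ∈ M) : 0 ≤ ⟪x - y, u⟫ := by
  have := h.normal.2 y hy
  rw [← neg_sub, inner_neg_left] at this
  linarith

theorem inner_le (h : TouchesInside M r x u) {y : 𝔼} (hy : y ∈ frontier M) :
    ⟪x - y, u⟫ ≤ ‖y - x‖ ^ 2 / (2 * r) :=
  inner_le_of_closedBall_subset h.pos h.normal.1 h.ball hy.2

/-- Normals at points with inner touching balls depend on the point in a Lipschitz way. -/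
theorem norm_sub_le (h : TouchesInside M r x u) {y v : 𝔼} (h' : TouchesInside M r y v) :
    ‖u - v‖ ≤ ‖x - y‖ / r := by
  have hr := h.pos
  have h1 := norm_sub_sq_le_of_closedBall_subset h.pos.le h.normal.1 h.ball h'.normal
  have h2 := h'.inner_le h.mem_frontier
  have h3 : ‖u - v‖ ^ 2 ≤ (‖x - y‖ / r) ^ 2 := by
    rw [div_pow, le_div_iff₀ (by positivity)]
    have := h1.trans h2
    rw [le_div_iff₀ (by positivity)] at this
    linarith
  exact le_of_sq_le_sq h3 (by positivity)

/-- Normals at arbitrary points close to a point with an inner touching ball. -/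
theorem norm_sub_sq_le (h : TouchesInside M r x u) {y v : 𝔼} (hv : IsOuterNormal M y v) :
    ‖u - v‖ ^ 2 ≤ 2 / r * ‖y - x‖ := by
  have hr := h.pos
  have h1 := norm_sub_sq_le_of_closedBall_subset h.pos.le h.normal.1 h.ball hv
  have h2 : ⟪y - x, v⟫ ≤ ‖y - x‖ := by
    simpa [hv.1] using real_inner_le_norm (y - x) v
  have h3 : r * ‖u - v‖ ^ 2 ≤ 2 * ‖y - x‖ := by linarith
  rw [div_mul_eq_mul_div, le_div_iff₀ hr]
  linarith

/-- Every tangent direction is realized by boundary points: below `x + v` there is a boundary point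
at height of second order. -/
theorem exists_mem_frontier (h : TouchesInside M r x u) {v : 𝔼} (hv : ⟪v, u⟫ = 0)
    (hvr : ‖v‖ ≤ r) : ∃ s : ℝ, 0 ≤ s ∧ s ≤ ‖v‖ ^ 2 / r ∧ x + v - s • u ∈ frontier M := by
  have hr := h.pos
  have hu := h.normal.1
  set T : ℝ := ‖v‖ ^ 2 / r with hT
  have hT0 : 0 ≤ T := by positivity
  have hin : x + v - T • u ∈ M := by
    apply h.ball
    rw [mem_closedBall, dist_eq_norm]
    have h1 : x + v - T • u - (x - r • u) = v + (r - T) • u := by rw [sub_smul]; abel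
    have h2 : ‖v + (r - T) • u‖ ^ 2 ≤ r ^ 2 := by
      rw [norm_add_sq_real, inner_smul_right, hv, norm_smul, hu, mul_one, Real.norm_eq_abs, sq_abs]
      have h3 : ‖v‖ ^ 2 = T * r := by rw [hT]; field_simp
      have h4 : T ≤ r := by
        rw [hT, div_le_iff₀ hr, ← sq]; gcongr
      nlinarith
    rw [h1]
    exact le_of_sq_le_sq h2 hr.le
  by_cases hxv : x + v ∈ M
  · refine ⟨0, le_rfl, hT0, ?_⟩
    rw [zero_smul, sub_zero]
    refine ⟨subset_closure hxv, IsOuterNormal.notMem_interior (u := u) ⟨hu, fun y hy => ?_⟩⟩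
    have := h.normal.2 y hy
    rw [← sub_sub, inner_sub_left, hv]
    linarith
  · have hcont : ContinuousOn (fun s : ℝ => x + v - s • u) (Icc 0 T) := by fun_prop
    have hpre : IsPreconnected ((fun s : ℝ => x + v - s • u) '' Icc 0 T) :=
      isPreconnected_Icc.image _ hcont
    obtain ⟨y, ⟨s, hs, rfl⟩, hy⟩ := inter_frontier_nonempty_of_isPreconnected hpre
      ⟨_, ⟨T, ⟨hT0, le_rfl⟩, rfl⟩, hin⟩ ⟨_, ⟨0, ⟨le_rfl, hT0⟩, rfl⟩, by simpa using hxv⟩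
    exact ⟨s, hs.1, hs.2, hy⟩

end TouchesInside

/-! ### Uniqueness and bounds for the Weingarten map -/

/-- A quadratic form that vanishes in the normal direction is controlled by its values on chords
from `x` to nearby boundary points. -/
theorem TouchesInside.abs_inner_map_self_le {M : Set 𝔼} {r : ℝ} {x u : 𝔼}
    (h : TouchesInside M r x u) {B : 𝔼 →ₗ[ℝ] 𝔼} (hB : B.IsSymmetric) (hBu : B u = 0) {C : ℝ}
    (hC : 0 ≤ C) (hBC : ∀ᶠ y in 𝓝[frontier M] x, |⟪B (y - x), y - x⟫| ≤ C * ‖y - x‖ ^ 2)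
    (w : 𝔼) : |⟪B w, w⟫| ≤ C * ‖w‖ ^ 2 := by
  have hr := h.pos
  have hu := h.normal.1
  have huB : ∀ a, ⟪B a, u⟫ = 0 := fun a => by rw [hB a u, hBu, inner_zero_right]
  have key : ∀ (v : 𝔼) (s : ℝ), ⟪B (v - s • u), v - s • u⟫ = ⟪B v, v⟫ := fun v s => by
    simp [inner_sub_right, inner_smul_right, hBu, huB]
  set v : 𝔼 := w - ⟪w, u⟫ • u with hv
  have hvu : ⟪v, u⟫ = 0 := by
    rw [hv, inner_sub_left, inner_smul_left, real_inner_self_eq_norm_sq, hu]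
    simp
  have hwv : ‖v‖ ^ 2 ≤ ‖w‖ ^ 2 := by
    rw [hv, norm_sub_sq_real, inner_smul_right, norm_smul, hu, Real.norm_eq_abs, mul_one, sq_abs]
    nlinarith [sq_nonneg ⟪w, u⟫]
  rw [← key w ⟪w, u⟫, ← hv]
  refine le_trans ?_ (mul_le_mul_of_nonneg_left hwv hC)
  -- The points `x + t v - s(t) u` of the boundary approach `x` in the direction of the tangential part
  -- `v` of `w`, and `s(t) = O(t²)`; dividing by `t²` in the limit leaves the value of the form at `v`.
  have hex : ∀ t : ℝ, ∃ s : ℝ, ‖t • v‖ ≤ r →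
      0 ≤ s ∧ s ≤ ‖t • v‖ ^ 2 / r ∧ x + t • v - s • u ∈ frontier M := fun t => by
    by_cases ht : ‖t • v‖ ≤ r
    · obtain ⟨s, hs⟩ := h.exists_mem_frontier (v := t • v) (by rw [inner_smul_left, hvu, mul_zero]) ht
      exact ⟨s, fun _ => hs⟩
    · exact ⟨0, fun h => absurd h ht⟩
  choose s hs using hex
  have hsmall : ∀ᶠ t : ℝ in 𝓝[>] 0, ‖t • v‖ ≤ r := by
    have : Tendsto (fun t : ℝ => ‖t • v‖) (𝓝[>] 0) (𝓝 ‖(0 : ℝ) • v‖) := by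
      apply Tendsto.mono_left _ nhdsWithin_le_nhds
      exact Continuous.tendsto (by fun_prop) 0
    rw [zero_smul, norm_zero] at this
    exact this.eventually (Iic_mem_nhds hr)
  have hs0 : Tendsto s (𝓝[>] 0) (𝓝 0) := by
    have : Tendsto (fun t : ℝ => ‖t • v‖ ^ 2 / r) (𝓝[>] 0) (𝓝 (‖(0 : ℝ) • v‖ ^ 2 / r)) := by
      apply Tendsto.mono_left _ nhdsWithin_le_nhds
      exact Continuous.tendsto (by fun_prop) 0
    rw [zero_smul, norm_zero, zero_pow two_ne_zero, zero_div] at this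
    refine tendsto_of_tendsto_of_tendsto_of_le_of_le' tendsto_const_nhds this ?_ ?_
    · filter_upwards [hsmall] with t ht using (hs t ht).1
    · filter_upwards [hsmall] with t ht using (hs t ht).2.1
  have hy : Tendsto (fun t : ℝ => x + t • v - s t • u) (𝓝[>] 0) (𝓝[frontier M] x) := by
    apply tendsto_nhdsWithin_of_tendsto_nhds_of_eventually_within
    · have h1 : Tendsto (fun t : ℝ => t) (𝓝[>] 0) (𝓝 0) := tendsto_id.mono_left nhdsWithin_le_nhds
      have := ((h1.smul_const v).const_add x).sub (hs0.smul_const u)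
      simpa using this
    · filter_upwards [hsmall] with t ht using (hs t ht).2.2
  have hlim : Tendsto (fun t : ℝ => C * (‖v‖ ^ 2 + t ^ 2 * (‖v‖ ^ 2 / r) ^ 2)) (𝓝[>] 0)
      (𝓝 (C * (‖v‖ ^ 2 + (0 : ℝ) ^ 2 * (‖v‖ ^ 2 / r) ^ 2))) := by
    apply Tendsto.mono_left _ nhdsWithin_le_nhds
    exact Continuous.tendsto (by fun_prop) 0
  rw [zero_pow two_ne_zero, zero_mul, add_zero] at hlim
  refine ge_of_tendsto hlim ?_
  filter_upwards [hsmall, hy.eventually hBC, self_mem_nhdsWithin] with t ht hBt ht0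
  have ht0 : 0 < t := ht0
  have e1 : x + t • v - s t • u - x = t • v - s t • u := by abel
  have e2 : ‖t • v - s t • u‖ ^ 2 = t ^ 2 * ‖v‖ ^ 2 + s t ^ 2 := by
    rw [norm_sub_sq_real, inner_smul_right, inner_smul_left, hvu, norm_smul, norm_smul, hu]
    simp [mul_pow]
  have e3 : s t ^ 2 ≤ t ^ 2 * (t ^ 2 * (‖v‖ ^ 2 / r) ^ 2) := by
    calc s t ^ 2 ≤ (‖t • v‖ ^ 2 / r) ^ 2 := by
          have := (hs t ht).1; have := (hs t ht).2.1; gcongr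
      _ = t ^ 2 * (t ^ 2 * (‖v‖ ^ 2 / r) ^ 2) := by
          rw [norm_smul, Real.norm_eq_abs, mul_pow, sq_abs]; ring
  rw [e1, key, map_smul, inner_smul_left, inner_smul_right, e2, abs_mul, abs_mul] at hBt
  simp only [conj_trivial, abs_of_pos ht0] at hBt
  have h5 : t ^ 2 * |⟪B v, v⟫| ≤ t ^ 2 * (C * (‖v‖ ^ 2 + t ^ 2 * (‖v‖ ^ 2 / r) ^ 2)) := by
    calc t ^ 2 * |⟪B v, v⟫| = t * (t * |⟪B v, v⟫|) := by ring
      _ ≤ C * (t ^ 2 * ‖v‖ ^ 2 + s t ^ 2) := hBt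
      _ ≤ C * (t ^ 2 * ‖v‖ ^ 2 + t ^ 2 * (t ^ 2 * (‖v‖ ^ 2 / r) ^ 2)) := by gcongr
      _ = _ := by ring
  exact le_of_mul_le_mul_left h5 (by positivity)

/-- A bound for the quadratic form of a symmetric map is a bound for the map. -/
theorem norm_map_le_of_abs_inner_map_self_le {V : Type*} [NormedAddCommGroup V]
    [InnerProductSpace ℝ V] {A : V →ₗ[ℝ] V} (hA : A.IsSymmetric) {C : ℝ}
    (h : ∀ w, |⟪A w, w⟫| ≤ C * ‖w‖ ^ 2) (w : V) : ‖A w‖ ≤ C * ‖w‖ := by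
  by_cases hw : w = 0
  · simp [hw]
  by_cases hAw : A w = 0
  · have := (abs_nonneg _).trans (h w)
    rw [hAw, norm_zero]
    have hw' : 0 < ‖w‖ := norm_pos_iff.2 hw
    rw [sq, ← mul_assoc] at this
    exact nonneg_of_mul_nonneg_left this hw'
  have hw' : 0 < ‖w‖ := norm_pos_iff.2 hw
  have hAw' : 0 < ‖A w‖ := norm_pos_iff.2 hAw
  -- Polarize with a vector `z` of the length of `w` in the direction of `A w`.
  set z : V := (‖w‖ / ‖A w‖) • A w with hz
  have hzn : ‖z‖ = ‖w‖ := by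
    rw [hz, norm_smul, Real.norm_of_nonneg (by positivity), div_mul_cancel₀ _ hAw'.ne']
  have h1 := (abs_le.1 (h (w + z))).2
  have h2 := (abs_le.1 (h (w - z))).1
  have h3 := parallelogram_law_with_norm ℝ w z
  have h4 : ⟪A w, z⟫ = ‖w‖ * ‖A w‖ := by
    rw [hz, inner_smul_right, real_inner_self_eq_norm_sq]
    field_simp
  have h5 : ⟪A z, w⟫ = ⟪A w, z⟫ := by rw [hA z w, real_inner_comm]
  simp only [map_add, map_sub, inner_add_left, inner_add_right, inner_sub_left,
    inner_sub_right] at h1 h2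
  rw [hzn] at h3
  have h6 : ‖w‖ * ‖A w‖ ≤ ‖w‖ * (C * ‖w‖) := by
    have h7 := congrArg (C * ·) h3
    simp only [mul_add] at h7
    linarith
  exact le_of_mul_le_mul_left h6 hw'

/-- The generalized Weingarten map is unique at a point with an inner touching ball. -/
theorem TouchesInside.isWeingartenMap_unique {M : Set 𝔼} {r : ℝ} {x u : 𝔼}
    (h : TouchesInside M r x u) {A A' : 𝔼 →ₗ[ℝ] 𝔼} (hA : IsWeingartenMap M x A)
    (hA' : IsWeingartenMap M x A') : A = A' := by
  have hsymm : (A - A').IsSymmetric := hA.symmetric.sub hA'.symmetric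
  have hu : (A - A') u = 0 := by
    have h1 := hA.normal
    have h2 := hA'.normal
    rw [h.outerNormal_eq] at h1 h2
    simp [h1, h2]
  have hsmall : ∀ ε : ℝ, 0 < ε → ∀ w, |⟪(A - A') w, w⟫| ≤ ε * ‖w‖ ^ 2 := fun ε hε => by
    refine h.abs_inner_map_self_le hsymm hu hε.le ?_
    filter_upwards [(isLittleO_iff.1 (hA'.expansion.sub hA.expansion)) (half_pos hε)] with y hy
    rw [Real.norm_eq_abs, Real.norm_of_nonneg (sq_nonneg _)] at hy
    rw [LinearMap.sub_apply, inner_sub_left]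
    rw [abs_le] at hy ⊢
    constructor <;> linarith [hy.1, hy.2]
  have hzero : ∀ w, ⟪(A - A') w, w⟫ = 0 := fun w => by
    rw [← abs_eq_zero]
    refine le_antisymm (le_of_forall_pos_le_add fun ε hε => ?_) (abs_nonneg _)
    refine (hsmall (ε / (‖w‖ ^ 2 + 1)) (by positivity) w).trans ?_
    rw [zero_add, div_mul_eq_mul_div, div_le_iff₀ (by positivity)]
    nlinarith
  exact sub_eq_zero.1 (hsymm.inner_map_self_eq_zero.1 hzero)

theorem isWeingartenMap_weingartenMap {M : Set 𝔼} {x : 𝔼} (h : ∃ A, IsWeingartenMap M x A) :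
    IsWeingartenMap M x (weingartenMap M x) := by
  rw [weingartenMap, dif_pos h]
  exact h.choose_spec

/-- A ball that touches from inside bounds the generalized Weingarten map. -/
theorem TouchesInside.norm_weingartenMap_le {M : Set 𝔼} {r : ℝ} {x u : 𝔼}
    (h : TouchesInside M r x u) (hM : IsClosed M) (w : 𝔼) :
    ‖weingartenMap M x w‖ ≤ (1 / r + 2) * ‖w‖ := by
  have hr := h.pos
  by_cases hex : ∃ A, IsWeingartenMap M x A
  · have hA := isWeingartenMap_weingartenMap hex
    set A := weingartenMap M x
    have hAu := hA.normal
    have hexp := hA.expansion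
    rw [h.outerNormal_eq] at hAu hexp
    refine norm_map_le_of_abs_inner_map_self_le hA.symmetric (fun w => ?_) w
    refine h.abs_inner_map_self_le hA.symmetric hAu (by positivity) ?_ w
    filter_upwards [(isLittleO_iff.1 hexp) one_pos, self_mem_nhdsWithin] with y hy hyM
    rw [Real.norm_eq_abs, Real.norm_of_nonneg (sq_nonneg _), abs_le] at hy
    have h1 := h.inner_le hyM
    have h2 := h.inner_nonneg (hM.frontier_subset hyM)
    have h3 : ‖y - x‖ ^ 2 / (2 * r) = 1 / r * ‖y - x‖ ^ 2 / 2 := by field_simp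
    have h4 : 0 ≤ 1 / r * ‖y - x‖ ^ 2 := by positivity
    rw [abs_le]
    constructor <;> linarith [hy.1, hy.2]
  · rw [weingartenMap, dif_neg hex]
    simp only [LinearMap.zero_apply, norm_zero]
    positivity

/-! ### Locality of the normal and of the Weingarten map -/

theorem outerNormal_congr {M M' : Set 𝔼} {x : 𝔼}
    (h : ∀ u, IsOuterNormal M x u ↔ IsOuterNormal M' x u) : outerNormal M x = outerNormal M' x := by
  have : IsOuterNormal M x = IsOuterNormal M' x := funext fun u => propext (h u)
  unfold outerNormal
  generalize IsOuterNormal M x = P at this ⊢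
  subst this
  rfl

theorem weingartenMap_congr {M M' : Set 𝔼} {x : 𝔼}
    (h : ∀ A, IsWeingartenMap M x A ↔ IsWeingartenMap M' x A) :
    weingartenMap M x = weingartenMap M' x := by
  have : IsWeingartenMap M x = IsWeingartenMap M' x := funext fun u => propext (h u)
  unfold weingartenMap
  generalize IsWeingartenMap M x = P at this ⊢
  subst this
  rfl

theorem steinerIntegrand_congr {M M' : Set 𝔼} {x : 𝔼} (p : ℝ) (m k : ℕ)
    (hN : outerNormal M x = outerNormal M' x) (hW : weingartenMap M x = weingartenMap M' x) :
    steinerIntegrand p m k M x = steinerIntegrand p m k M' x := by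
  simp only [steinerIntegrand, curvatureH, principalCurvatures, hN, hW]

/-- Normality of a vector to a convex set is a local condition. -/
theorem IsOuterNormal.of_inter_subset {M M' U : Set 𝔼} {x u : 𝔼} (h : IsOuterNormal M x u)
    (hM' : Convex ℝ M') (hx : x ∈ M') (hU : IsOpen U) (hxU : x ∈ U) (hsub : M' ∩ U ⊆ M) :
    IsOuterNormal M' x u := by
  refine ⟨h.1, fun y hy => ?_⟩
  have hlim : Tendsto (fun t : ℝ => x + t • (y - x)) (𝓝[>] 0) (𝓝 (x + (0 : ℝ) • (y - x))) := by
    apply Tendsto.mono_left _ nhdsWithin_le_nhds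
    exact Continuous.tendsto (by fun_prop) 0
  rw [zero_smul, add_zero] at hlim
  have hev : ∀ᶠ t : ℝ in 𝓝[>] 0, t ∈ Ioc (0 : ℝ) 1 ∧ x + t • (y - x) ∈ U :=
    Filter.Eventually.and (Ioc_mem_nhdsGT one_pos) (hlim.eventually (hU.mem_nhds hxU))
  obtain ⟨t, ht, htU⟩ := hev.exists
  have h1 := h.2 _ (hsub ⟨hM'.add_smul_sub_mem hx hy ⟨ht.1.le, ht.2⟩, htU⟩)
  rw [add_sub_cancel_left, inner_smul_left] at h1
  exact nonpos_of_mul_nonpos_right h1 ht.1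

theorem steinerIntegrand_eq_of_inter_eq {M M' U : Set 𝔼} {x : 𝔼} (p : ℝ) (m k : ℕ)
    (hM : Convex ℝ M) (hM' : Convex ℝ M') (hx : x ∈ M) (hU : IsOpen U) (hxU : x ∈ U)
    (h : M ∩ U = M' ∩ U) : steinerIntegrand p m k M x = steinerIntegrand p m k M' x := by
  have hx' : x ∈ M' := by
    have : x ∈ M ∩ U := ⟨hx, hxU⟩
    rw [h] at this
    exact this.1
  have hN : outerNormal M x = outerNormal M' x := outerNormal_congr fun u =>
    ⟨fun hu => hu.of_inter_subset hM' hx' hU hxU (h ▸ inter_subset_left),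
      fun hu => hu.of_inter_subset hM hx hU hxU (h ▸ inter_subset_left)⟩
  have hF : 𝓝[frontier M] x = 𝓝[frontier M'] x := by
    apply nhdsWithin_eq_nhdsWithin hxU hU
    rw [← frontier_inter_open_inter hU, h, frontier_inter_open_inter hU]
  refine steinerIntegrand_congr p m k hN (weingartenMap_congr fun A => ⟨fun hA => ?_, fun hA => ?_⟩)
  · exact ⟨hA.symmetric, hN ▸ hA.normal, hN ▸ hF ▸ hA.expansion⟩
  · exact ⟨hA.symmetric, hN ▸ hA.normal, hN ▸ hF ▸ hA.expansion⟩

/-! ### Second-order expansions along a non-porous part of the boundary -/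

/-- The set `E` is not porous in `F` at `x`: up to an error of smaller order than the distance to
`x`, points of `F` near `x` are points of `E`. -/
def IsNonporousAt (E F : Set 𝔼) (x : 𝔼) : Prop :=
  ∀ ε : ℝ, 0 < ε → ∀ᶠ y in 𝓝[F] x, ∃ z ∈ E, ‖y - z‖ ≤ ε * ‖y - x‖

/-- If a part `E` of the boundary of `M` with inner touching balls is not porous at `x`, the
second-order expansion of the boundary at `x` only needs to be tested along `E`. -/
theorem isWeingartenMap_iff_of_isNonporousAt {M E : Set 𝔼} {r : ℝ} {N : 𝔼 → 𝔼} (hM : IsClosed M)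
    (hE : ∀ z ∈ E, TouchesInside M r z (N z)) {x : 𝔼} (hx : x ∈ E)
    (hp : IsNonporousAt E (frontier M) x) (A : 𝔼 →ₗ[ℝ] 𝔼) :
    IsWeingartenMap M x A ↔ A.IsSymmetric ∧ A (N x) = 0 ∧
      (fun y => ⟪x - y, N x⟫ - (1 / 2 : ℝ) * ⟪A (y - x), y - x⟫) =o[𝓝[E] x]
        (fun y => ‖y - x‖ ^ 2) := by
  have hN := (hE x hx).outerNormal_eq
  have hr := (hE x hx).pos
  constructor
  · rintro ⟨h1, h2, h3⟩
    rw [hN] at h2 h3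
    exact ⟨h1, h2, h3.mono (nhdsWithin_mono x fun z hz => (hE z hz).mem_frontier)⟩
  · rintro ⟨h1, h2, h3⟩
    refine ⟨h1, by rwa [hN], ?_⟩
    rw [hN, isLittleO_iff]
    intro c hc
    set a : ℝ := ‖LinearMap.toContinuousLinearMap A‖ with ha
    have ha0 : 0 ≤ a := norm_nonneg _
    have hAle : ∀ w, ‖A w‖ ≤ a * ‖w‖ := fun w =>
      (LinearMap.toContinuousLinearMap A).le_opNorm w
    -- Replacing `y` by a point `z` of `E` with `‖y - z‖ ≤ δ d`, where `d = ‖y - x‖`, costs at most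
    -- `3 / r * δ d²` in the height and `3 / 2 * a * δ d²` in the quadratic form; the expansion at `z`
    -- costs `4 δ d²`.
    set D : ℝ := 3 / r + 2 * a + 4 with hD
    have hD0 : 0 < D := by positivity
    set δ : ℝ := min 1 (c / D) with hδ
    have hδ0 : 0 < δ := by positivity
    have hδ1 : δ ≤ 1 := min_le_left _ _
    have hδc : δ * D ≤ c := by
      rw [← le_div_iff₀ hD0]; exact min_le_right _ _
    obtain ⟨η, hη, hηE⟩ := Metric.mem_nhdsWithin_iff.1 ((isLittleO_iff.1 h3) hδ0)
    have hnear : ∀ᶠ y in 𝓝[frontier M] x, ‖y - x‖ < η / 2 :=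
      mem_nhdsWithin_of_mem_nhds (by
        filter_upwards [ball_mem_nhds x (half_pos hη)] with y hy
        rwa [← dist_eq_norm])
    filter_upwards [hp δ hδ0, hnear, self_mem_nhdsWithin] with y hy hyη hyM
    obtain ⟨z, hz, hyz⟩ := hy
    set d := ‖y - x‖ with hd
    have hd0 : 0 ≤ d := norm_nonneg _
    have hyzd : ‖y - z‖ ≤ d := hyz.trans (by nlinarith)
    have hzx : ‖z - x‖ ≤ 2 * d := by
      have : z - x = (y - x) - (y - z) := by abel
      rw [this]
      refine (norm_sub_le _ _).trans (by linarith)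
    have hzexp := hηE ⟨by rw [mem_ball, dist_eq_norm]; linarith, hz⟩
    simp only [mem_ofPred_eq, Real.norm_eq_abs, abs_pow, abs_norm] at hzexp
    have b1 : |⟪x - z, N x⟫ - 1 / 2 * ⟪A (z - x), z - x⟫| ≤ 4 * (δ * d ^ 2) := by
      refine hzexp.trans ?_
      have : ‖z - x‖ ^ 2 ≤ (2 * d) ^ 2 := by gcongr
      nlinarith
    have b2 : |⟪z - y, N z⟫| ≤ 1 / r * (δ * d ^ 2) := by
      rw [abs_of_nonneg ((hE z hz).inner_nonneg (hM.frontier_subset hyM))]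
      refine ((hE z hz).inner_le hyM).trans ?_
      rw [div_mul_eq_mul_div, one_mul]
      have : ‖y - z‖ ^ 2 ≤ δ * d ^ 2 := by nlinarith [norm_nonneg (y - z)]
      calc ‖y - z‖ ^ 2 / (2 * r) ≤ δ * d ^ 2 / (2 * r) := by gcongr
        _ ≤ δ * d ^ 2 / r := by
          apply div_le_div_of_nonneg_left (by positivity) hr; linarith
    have b3 : |⟪z - y, N x - N z⟫| ≤ 2 / r * (δ * d ^ 2) := by
      refine (abs_real_inner_le_norm _ _).trans ?_
      have hL := (hE x hx).norm_sub_le (hE z hz)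
      rw [norm_sub_rev x z] at hL
      rw [norm_sub_rev z y]
      calc ‖y - z‖ * ‖N x - N z‖ ≤ (δ * d) * (2 * d / r) := by gcongr; exact hL.trans (by gcongr)
        _ = 2 / r * (δ * d ^ 2) := by ring
    have b4 : |⟪A (y - x), y - x⟫ - ⟪A (z - x), z - x⟫| ≤ 3 * a * (δ * d ^ 2) := by
      have e : ⟪A (y - x), y - x⟫ - ⟪A (z - x), z - x⟫
          = ⟪A (y - z), y - x⟫ + ⟪A (z - x), y - z⟫ := by
        have e1 : y - x = (y - z) + (z - x) := by abel
        rw [e1]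
        simp only [map_add, inner_add_left, inner_add_right]
        ring
      rw [e]
      refine (abs_add_le _ _).trans ?_
      have i1 : |⟪A (y - z), y - x⟫| ≤ a * (δ * d) * d :=
        (abs_real_inner_le_norm _ _).trans (by gcongr; exact (hAle _).trans (by gcongr))
      have i2 : |⟪A (z - x), y - z⟫| ≤ a * (2 * d) * (δ * d) :=
        (abs_real_inner_le_norm _ _).trans (by gcongr; exact (hAle _).trans (by gcongr))
      linarith
    -- The height difference is split by means of the normal at `z`: the first part is quadratic in
    -- `‖y - z‖`, the second is small because the normal is Lipschitz.
    have e0 : ⟪x - y, N x⟫ = ⟪x - z, N x⟫ + ⟪z - y, N z⟫ + ⟪z - y, N x - N z⟫ := by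
      rw [inner_sub_right, add_add_sub_cancel, ← inner_add_left, sub_add_sub_cancel]
    rw [Real.norm_eq_abs, Real.norm_of_nonneg (by positivity)]
    have hfin : 3 / r * (δ * d ^ 2) + 2 * a * (δ * d ^ 2) + 4 * (δ * d ^ 2) ≤ c * d ^ 2 := by
      have := mul_le_mul_of_nonneg_right hδc (sq_nonneg d)
      rw [hD] at this
      linarith
    have h3r : 3 / r * (δ * d ^ 2) = 1 / r * (δ * d ^ 2) + 2 / r * (δ * d ^ 2) := by ring
    have hpos : 0 ≤ a * (δ * d ^ 2) := by positivity
    rw [abs_le] at b1 b2 b3 b4 ⊢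
    constructor <;> linarith [b1.1, b1.2, b2.1, b2.2, b3.1, b3.2, b4.1, b4.2]

/-! ### Boundary measure and projections to hyperplanes -/

open scoped NNReal ENNReal

theorem euclideanHausdorffMeasure_le_of_antilipschitzOn {X Y : Type*} [EMetricSpace X]
    [MeasurableSpace X] [BorelSpace X] [EMetricSpace Y] [MeasurableSpace Y] [BorelSpace Y]
    {f : X → Y} {S : Set X} {K : ℝ≥0} (h : ∀ x ∈ S, ∀ y ∈ S, edist x y ≤ K * edist (f x) (f y))
    (d : ℕ) : (μHE[d] : Measure X) S ≤ (K : ℝ≥0∞) ^ (d : ℝ) * (μHE[d] : Measure Y) (f '' S) := by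
  have hf : AntilipschitzWith K (fun x : S => f x) := fun x y => h x x.2 y y.2
  have h1 := hf.le_hausdorffMeasure_image (d := d) (Nat.cast_nonneg d) univ
  have h2 := (isometry_subtype_coe (s := S)).hausdorffMeasure_image (d := d)
    (Or.inl (Nat.cast_nonneg d)) univ
  rw [image_univ, Subtype.range_coe] at h2
  have h3 : (fun x : S => f x) '' univ = f '' S := by
    rw [image_univ]; exact (image_eq_range f S).symm
  rw [← h2, h3] at h1
  rw [Measure.euclideanHausdorffMeasure_def, Measure.euclideanHausdorffMeasure_def,
    Measure.smul_apply, Measure.smul_apply, ENNReal.smul_def, ENNReal.smul_def, smul_eq_mul,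
    smul_eq_mul, mul_left_comm]
  gcongr

/-- The orthogonal projection to the hyperplane with normal vector `u`. -/
abbrev hyperplaneProj (u : 𝔼) : 𝔼 →L[ℝ] (ℝ ∙ u)ᗮ := (ℝ ∙ u)ᗮ.orthogonalProjectionOnto

theorem norm_hyperplaneProj_sq {u : 𝔼} (hu : ‖u‖ = 1) (d : 𝔼) :
    ‖hyperplaneProj u d‖ ^ 2 = ‖d‖ ^ 2 - ⟪d, u⟫ ^ 2 := by
  have h1 := Submodule.norm_sq_eq_add_norm_sq_starProjection d (ℝ ∙ u)
  rw [Submodule.starProjection_unit_singleton ℝ hu, norm_smul, hu, mul_one, Real.norm_eq_abs, sq_abs,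
    real_inner_comm] at h1
  have h2 : ‖hyperplaneProj u d‖ = ‖(ℝ ∙ u)ᗮ.starProjection d‖ := by
    rw [Submodule.starProjection_apply, Submodule.coe_norm]
  rw [h2]
  linarith

/-- On the part of the boundary whose normals are close to `u`, the projection along `u` distorts
distances by a factor of at most `2`. -/
theorem norm_sub_le_two_mul_norm_hyperplaneProj {M : Set 𝔼} {u y z v w : 𝔼} (hu : ‖u‖ = 1)
    (hy : y ∈ M) (hz : z ∈ M) (hv : IsOuterNormal M y v) (hw : IsOuterNormal M z w)
    (hvu : ‖v - u‖ ≤ 1 / 2) (hwu : ‖w - u‖ ≤ 1 / 2) :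
    ‖y - z‖ ≤ 2 * ‖hyperplaneProj u y - hyperplaneProj u z‖ := by
  rw [← map_sub]
  have h1 := hv.2 z hz
  have h2 := hw.2 y hy
  set d := y - z with hd
  rw [← neg_sub y z, inner_neg_left, ← hd] at h1
  have b1 := (abs_real_inner_le_norm d (v - u)).trans
    (mul_le_mul_of_nonneg_left hvu (norm_nonneg d))
  have b2 := (abs_real_inner_le_norm d (w - u)).trans
    (mul_le_mul_of_nonneg_left hwu (norm_nonneg d))
  rw [inner_sub_right, abs_le] at b1 b2
  have h3 : |⟪d, u⟫| ≤ ‖d‖ / 2 := by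
    rw [abs_le]
    constructor <;> linarith [b1.1, b1.2, b2.1, b2.2]
  have h4 : ⟪d, u⟫ ^ 2 ≤ (‖d‖ / 2) ^ 2 := sq_le_sq' (by linarith [(abs_le.1 h3).1]) (abs_le.1 h3).2
  have h5 := norm_hyperplaneProj_sq hu d
  refine le_of_sq_le_sq ?_ (by positivity)
  nlinarith [sq_nonneg ‖d‖]

theorem finrank_hyperplane {u : 𝔼} (hu : ‖u‖ = 1) : Module.finrank ℝ (ℝ ∙ u)ᗮ = n - 1 := by
  have h1 := Submodule.finrank_add_finrank_orthogonal (ℝ ∙ u)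
  rw [finrank_span_singleton (by rintro rfl; simp at hu), finrank_euclideanSpace_fin] at h1
  omega

theorem isAddHaarMeasure_hyperplane {u : 𝔼} (hu : ‖u‖ = 1) :
    (μHE[n - 1] : Measure (ℝ ∙ u)ᗮ).IsAddHaarMeasure := by
  rw [← finrank_hyperplane hu]
  infer_instance

/-- The part of `E` where the vector field `N` is close to `u`. -/
def normalPatch (E : Set 𝔼) (N : 𝔼 → 𝔼) (u : 𝔼) : Set 𝔼 := {z ∈ E | ‖N z - u‖ ≤ 1 / 2}

theorem measure_le_measure_image_hyperplaneProj {M S : Set 𝔼} {N : 𝔼 → 𝔼} {u : 𝔼} (hu : ‖u‖ = 1)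
    (hSM : S ⊆ M) (hN : ∀ z ∈ S, IsOuterNormal M z (N z)) (hS : S ⊆ normalPatch S N u) :
    (μHE[n - 1] : Measure 𝔼) S
      ≤ (2 : ℝ≥0) ^ ((n - 1 : ℕ) : ℝ) * (μHE[n - 1] : Measure (ℝ ∙ u)ᗮ) (hyperplaneProj u '' S) := by
  refine (euclideanHausdorffMeasure_le_of_antilipschitzOn (K := 2) (f := hyperplaneProj u)
    (fun y hy z hz => ?_) (n - 1)).trans (by simp)
  have := norm_sub_le_two_mul_norm_hyperplaneProj hu (hSM hy) (hSM hz) (hN y hy) (hN z hz)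
    (hS hy).2 (hS hz).2
  rw [edist_dist, edist_dist, dist_eq_norm, dist_eq_norm,
    show ((2 : ℝ≥0) : ℝ≥0∞) = ENNReal.ofReal 2 by simp, ← ENNReal.ofReal_mul (by norm_num)]
  exact ENNReal.ofReal_le_ofReal this

/-- Finitely many directions suffice to approximate all unit vectors. -/
theorem exists_finite_directions :
    ∃ t : Set 𝔼, t.Finite ∧ (∀ u ∈ t, ‖u‖ = 1) ∧ ∀ v : 𝔼, ‖v‖ = 1 → ∃ u ∈ t, ‖v - u‖ < 1 / 4 := by
  obtain ⟨t, ht, hfin, hcov⟩ := (isCompact_sphere (0 : 𝔼) 1).finite_cover_balls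
    (show (0 : ℝ) < 1 / 4 by norm_num)
  refine ⟨t, hfin, fun u hu => by simpa using ht hu, fun v hv => ?_⟩
  have := hcov (show v ∈ sphere (0 : 𝔼) 1 by simpa using hv)
  simpa [dist_eq_norm] using this

/-- The boundary of a convex body has finite area. -/
theorem measure_frontier_lt_top {M : Set 𝔼} (hc : Convex ℝ M) (hk : IsCompact M)
    (hi : (interior M).Nonempty) : (μHE[n - 1] : Measure 𝔼) (frontier M) < ∞ := by
  obtain ⟨t, hfin, hunit, ht⟩ := exists_finite_directions (n := n)
  have hN : ∀ z ∈ frontier M, IsOuterNormal M z (outerNormal M z) := fun z hz =>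
    isOuterNormal_outerNormal (exists_isOuterNormal hc hi hz)
  have hfM : frontier M ⊆ M := hk.isClosed.frontier_subset
  have hcov : frontier M ⊆ ⋃ u ∈ t, normalPatch (frontier M) (outerNormal M) u := fun z hz => by
    obtain ⟨u, hu, huz⟩ := ht _ (hN z hz).1
    exact mem_biUnion hu ⟨hz, by linarith⟩
  refine (measure_mono hcov).trans_lt ((measure_biUnion_lt_top hfin fun u hu => ?_))
  have hsub : normalPatch (frontier M) (outerNormal M) u ⊆ frontier M := fun z hz => hz.1
  refine (measure_le_measure_image_hyperplaneProj (hunit u hu) (hsub.trans hfM)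
    (fun z hz => hN z hz.1) (fun z hz => ⟨hz, hz.2⟩)).trans_lt ?_
  have := isAddHaarMeasure_hyperplane (hunit u hu)
  refine ENNReal.mul_lt_top (by simp) ?_
  have hb : Bornology.IsBounded (normalPatch (frontier M) (outerNormal M) u) :=
    hk.isBounded.subset (hsub.trans hfM)
  exact ((hyperplaneProj u).lipschitz.isBounded_image hb).measure_lt_top

/-- Almost every point of `E` is a point of non-porosity of `E` in the boundary of `M`: otherwise
the projection of `E` to a hyperplane would miss balls of comparable size arbitrarily close to a
Lebesgue density point. -/
theorem ae_isNonporousAt {M E : Set 𝔼} {r : ℝ} {N : 𝔼 → 𝔼} (hc : Convex ℝ M) (hM : IsClosed M)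
    (hi : (interior M).Nonempty) (hEm : MeasurableSet E)
    (hE : ∀ z ∈ E, TouchesInside M r z (N z)) :
    ∀ᵐ x ∂(μHE[n - 1] : Measure 𝔼).restrict E, IsNonporousAt E (frontier M) x := by
  obtain ⟨t, hfin, hunit, ht⟩ := exists_finite_directions (n := n)
  rw [ae_restrict_iff' hEm, ae_iff]
  -- With `j + 2` instead of `j + 1` the error factor is below `1`, so that points `y` witnessing
  -- porosity satisfy `y ≠ x`.
  let bad (u : 𝔼) (j : ℕ) : Set 𝔼 := {x ∈ E | ‖N x - u‖ < 1 / 4 ∧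
    ¬ ∀ᶠ y in 𝓝[frontier M] x, ∃ z ∈ E, ‖y - z‖ ≤ 1 / ((j : ℝ) + 1 + 1) * ‖y - x‖}
  have hsub : {x | ¬ (x ∈ E → IsNonporousAt E (frontier M) x)} ⊆ ⋃ u ∈ t, ⋃ j, bad u j := by
    intro x hx
    simp only [mem_ofPred_eq, Classical.not_imp, IsNonporousAt, not_forall] at hx
    obtain ⟨hxE, ε, hε, hbad⟩ := hx
    obtain ⟨u, hu, hux⟩ := ht _ (hE x hxE).normal.1
    obtain ⟨j, hj⟩ := exists_nat_one_div_lt hε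
    refine mem_biUnion hu (mem_iUnion.2 ⟨j, hxE, hux, fun hev => hbad ?_⟩)
    filter_upwards [hev] with y ⟨z, hz, hyz⟩
    refine ⟨z, hz, hyz.trans ?_⟩
    gcongr
    refine le_trans ?_ hj.le
    apply one_div_le_one_div_of_le <;> linarith [(Nat.cast_nonneg j : (0 : ℝ) ≤ j)]
  refine measure_mono_null hsub ((measure_biUnion_null_iff hfin.countable).2 fun u hu =>
    measure_iUnion_null fun j => ?_)
  have hhaar := isAddHaarMeasure_hyperplane (hunit u hu)
  set P := hyperplaneProj u with hP
  set T : Set (ℝ ∙ u)ᗮ := P '' normalPatch E N u with hT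
  have hbadE : bad u j ⊆ normalPatch E N u := fun x hx => ⟨hx.1, by linarith [hx.2.1]⟩
  have hEM : E ⊆ M := fun z hz => (hE z hz).mem
  have hproj : (μHE[n - 1] : Measure (ℝ ∙ u)ᗮ) (P '' bad u j) = 0 := by
    have hj0 : (0 : ℝ) < (j : ℝ) + 1 + 1 := by positivity
    have hdens := IsUnifLocDoublingMeasure.ae_tendsto_measure_inter_div
      (μHE[n - 1] : Measure (ℝ ∙ u)ᗮ) T (2 * ((j : ℝ) + 1 + 1))
    rw [ae_iff] at hdens
    -- Points of `P '' bad u j` lie in `T` but are not density points of `T`.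
    refine measure_mono_null ?_ (le_antisymm ((Measure.le_restrict_apply T _).trans hdens.le) zero_le)
    rintro _ ⟨x, hx, rfl⟩
    refine ⟨?_, ⟨x, hbadE hx, rfl⟩⟩
    intro hlim
    have hxE := hx.1
    have hr := (hE x hxE).pos
    have hfreq := hx.2.2
    rw [not_eventually, frequently_iff_neBot] at hfreq
    set l := 𝓝[frontier M] x ⊓ 𝓟 {y | ¬ ∃ z ∈ E, ‖y - z‖ ≤ 1 / ((j : ℝ) + 1 + 1) * ‖y - x‖} with hl
    have hgood : ∀ᶠ y in l, ∀ z ∈ E, 1 / ((j : ℝ) + 1 + 1) * ‖y - x‖ < ‖y - z‖ := by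
      filter_upwards [mem_inf_of_right (mem_principal_self _)] with y hy z hz
      by_contra hcon
      exact hy ⟨z, hz, not_lt.1 hcon⟩
    have hfr : ∀ᶠ y in l, y ∈ frontier M := mem_inf_of_left self_mem_nhdsWithin
    have hlx : Tendsto (fun y => ‖y - x‖) l (𝓝 0) := by
      have h1 : Tendsto (fun y => ‖y - x‖) (𝓝 x) (𝓝 ‖x - x‖) :=
        Continuous.tendsto (by fun_prop) x
      rw [sub_self, norm_zero] at h1
      exact h1.mono_left (inf_le_left.trans nhdsWithin_le_nhds)
    have hpos : ∀ᶠ y in l, 0 < ‖y - x‖ := by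
      filter_upwards [hgood] with y hy
      exact lt_of_le_of_lt (by positivity) (hy x hxE)
    have hδ : Tendsto (fun y => ‖y - x‖ / (2 * ((j : ℝ) + 1 + 1))) l (𝓝[>] 0) := by
      apply tendsto_nhdsWithin_of_tendsto_nhds_of_eventually_within
      · simpa using hlx.div_const (2 * ((j : ℝ) + 1 + 1))
      · filter_upwards [hpos] with y hy using div_pos hy (by positivity)
    have hball : ∀ᶠ y in l, P x ∈ closedBall (P y)
        (2 * ((j : ℝ) + 1 + 1) * (‖y - x‖ / (2 * ((j : ℝ) + 1 + 1)))) := by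
      refine Eventually.of_forall fun y => ?_
      rw [mul_div_cancel₀ _ (by positivity), mem_closedBall, dist_eq_norm, ← map_sub, norm_sub_rev]
      refine (P.le_opNorm _).trans ?_
      rw [norm_sub_rev x y]
      exact mul_le_of_le_one_left (norm_nonneg _) (Submodule.orthogonalProjectionOnto_norm_le _)
    -- The balls around the projections of the exceptional points do not meet `T`.
    have hempty : ∀ᶠ y in l, T ∩ closedBall (P y) (‖y - x‖ / (2 * ((j : ℝ) + 1 + 1))) = ∅ := by
      have hclose : ∀ᶠ y in l, ‖y - x‖ < r / 32 := hlx.eventually (Iio_mem_nhds (by positivity))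
      filter_upwards [hgood, hfr, hclose] with y hy hyM hyr
      rw [← not_nonempty_iff_eq_empty]
      rintro ⟨_, ⟨z, hz, rfl⟩, hzy⟩
      obtain ⟨v, hv⟩ := exists_isOuterNormal hc hi hyM
      have hvu : ‖v - u‖ ≤ 1 / 2 := by
        have h1 := (hE x hxE).norm_sub_sq_le hv
        have h2 : ‖N x - v‖ ^ 2 ≤ (1 / 4) ^ 2 := by
          refine h1.trans ?_
          rw [div_mul_eq_mul_div, div_le_iff₀ hr]
          linarith
        have h3 : ‖N x - v‖ ≤ 1 / 4 := le_of_sq_le_sq h2 (by norm_num)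
        have h4 : v - u = (N x - u) - (N x - v) := by abel
        rw [h4]
        refine (norm_sub_le _ _).trans ?_
        linarith [hx.2.1]
      have h5 := norm_sub_le_two_mul_norm_hyperplaneProj (hunit u hu) (hM.frontier_subset hyM)
        (hEM hz.1) hv (hE z hz.1).normal hvu hz.2
      have h6 := hy z hz.1
      rw [mem_closedBall, dist_eq_norm, norm_sub_rev] at hzy
      have h7 : 1 / ((j : ℝ) + 1 + 1) * ‖y - x‖ = 2 * (‖y - x‖ / (2 * ((j : ℝ) + 1 + 1))) := by
        field_simp
      linarith
    have h1 := hlim (fun y => P y) _ hδ hball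
    have h0 : Tendsto (fun _ : 𝔼 => (0 : ℝ≥0∞)) l (𝓝 1) := by
      refine h1.congr' ?_
      filter_upwards [hempty] with y hy
      rw [hy, measure_empty, ENNReal.zero_div]
    exact zero_ne_one (tendsto_nhds_unique tendsto_const_nhds h0)
  refine le_antisymm ((measure_le_measure_image_hyperplaneProj (N := N) (hunit u hu)
    (fun z hz => hEM hz.1) (fun z hz => (hE z hz.1).normal) (fun z hz => ⟨hz, (hbadE hz).2⟩)).trans
    ?_) zero_le
  rw [← hP, hproj, mul_zero]

/-! ### Measurability of the Weingarten map -/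

theorem exists_touchesInside_of_mem_rollingClass {K : Set 𝔼} (hK : K ∈ rollingClass n) :
    ∃ r : ℝ, 0 < r ∧ ∀ x ∈ frontier K, TouchesInside K r x (outerNormal K x) := by
  obtain ⟨hb, ⟨r, hr, hin⟩, -⟩ := hK
  refine ⟨r, hr, fun x hx => ?_⟩
  have := isOuterNormal_outerNormal (exists_isOuterNormal hb.isConvex ⟨0, hb.zero_mem⟩ hx)
  exact ⟨hr, this, hin x hx _ this⟩

theorem continuousOn_outerNormal {K : Set 𝔼} {r : ℝ}
    (hK : ∀ x ∈ frontier K, TouchesInside K r x (outerNormal K x)) :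
    ContinuousOn (outerNormal K) (frontier K) := by
  intro x hx
  have hr := (hK x hx).pos
  have h1 : Tendsto (fun y => ‖x - y‖ / r) (𝓝[frontier K] x) (𝓝 0) := by
    have h2 : Tendsto (fun y => ‖x - y‖ / r) (𝓝 x) (𝓝 (‖x - x‖ / r)) :=
      Continuous.tendsto (by fun_prop) x
    rw [sub_self, norm_zero, zero_div] at h2
    exact h2.mono_left nhdsWithin_le_nhds
  refine tendsto_iff_norm_sub_tendsto_zero.2 (squeeze_zero' (Eventually.of_forall fun y =>
    norm_nonneg _) ?_ h1)
  filter_upwards [self_mem_nhdsWithin] with y hy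
  rw [norm_sub_rev]
  exact (hK x hx).norm_sub_le (hK y hy)

/-- A function whose graph over `D` is Borel is Borel on `D`: preimages are injective images of
Borel subsets of the graph. -/
theorem measurable_indicator_of_measurableSet_graph {X Y : Type*} [MeasurableSpace X]
    [StandardBorelSpace X] [MeasurableSpace Y] [StandardBorelSpace Y] [Zero Y] {D : Set X}
    {f : X → Y} (h : MeasurableSet {p : X × Y | p.1 ∈ D ∧ p.2 = f p.1}) :
    Measurable (D.indicator f) := by
  have key : ∀ B : Set Y, MeasurableSet B → MeasurableSet (f ⁻¹' B ∩ D) := fun B hB => by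
    have h1 : MeasurableSet ({p : X × Y | p.1 ∈ D ∧ p.2 = f p.1} ∩ Prod.snd ⁻¹' B) :=
      h.inter (measurable_snd hB)
    have h2 : InjOn Prod.fst ({p : X × Y | p.1 ∈ D ∧ p.2 = f p.1} ∩ Prod.snd ⁻¹' B) := by
      rintro ⟨a, b⟩ ⟨⟨-, hb⟩, -⟩ ⟨a', b'⟩ ⟨⟨-, hb'⟩, -⟩ (rfl : a = a')
      exact Prod.ext rfl (hb.trans hb'.symm)
    have h3 := h1.image_of_measurable_injOn measurable_fst h2
    convert h3 using 1
    ext x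
    constructor
    · rintro ⟨hx, hxD⟩
      exact ⟨(x, f x), ⟨⟨hxD, rfl⟩, hx⟩, rfl⟩
    · rintro ⟨⟨a, b⟩, ⟨⟨hD, hb⟩, hB⟩, rfl⟩
      exact ⟨by simpa [← show b = f a from hb] using hB, hD⟩
  have hD : MeasurableSet D := by simpa using key univ MeasurableSet.univ
  intro B hB
  rw [indicator_preimage, Set.ite]
  exact (key B hB).union ((measurable_const (a := (0 : Y)) hB).diff hD)

/-- The Weingarten map as a continuous linear map. -/
def weingartenCLM (K : Set 𝔼) (x : 𝔼) : 𝔼 →L[ℝ] 𝔼 :=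
  LinearMap.toContinuousLinearMap (weingartenMap K x)

/-- A quantitative form of the second-order expansion, at scale `δ` and with error `ε`. -/
def expansionSet (K : Set 𝔼) (ε δ : ℝ) : Set (𝔼 × (𝔼 →L[ℝ] 𝔼)) :=
  {q | q.1 ∈ frontier K ∧ ∀ y ∈ frontier K, ‖y - q.1‖ < δ →
    |⟪q.1 - y, outerNormal K q.1⟫ - (1 / 2 : ℝ) * ⟪q.2 (y - q.1), y - q.1⟫| ≤ ε * ‖y - q.1‖ ^ 2}

theorem isClosed_expansionSet {K : Set 𝔼} (hN : ContinuousOn (outerNormal K) (frontier K))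
    (ε δ : ℝ) : IsClosed (expansionSet K ε δ) := by
  have hS : IsClosed (frontier K ×ˢ (univ : Set (𝔼 →L[ℝ] 𝔼))) := isClosed_frontier.prod isClosed_univ
  have hN' : ContinuousOn (fun q : 𝔼 × (𝔼 →L[ℝ] 𝔼) => outerNormal K q.1) (frontier K ×ˢ univ) :=
    hN.comp continuousOn_fst fun q hq => hq.1
  have : expansionSet K ε δ = (frontier K ×ˢ (univ : Set (𝔼 →L[ℝ] 𝔼))) ∩ ⋂ y ∈ frontier K,
      (((frontier K ×ˢ univ) ∩ (fun q => ‖y - q.1‖) ⁻¹' Ici δ) ∪ ((frontier K ×ˢ univ) ∩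
        (fun q => |⟪q.1 - y, outerNormal K q.1⟫ - (1 / 2 : ℝ) * ⟪q.2 (y - q.1), y - q.1⟫|
          - ε * ‖y - q.1‖ ^ 2) ⁻¹' Iic 0)) := by
    ext q
    simp only [expansionSet, mem_ofPred_eq, mem_inter_iff, mem_prod, mem_univ, and_true,
      mem_iInter, mem_union, mem_preimage, mem_Ici, mem_Iic, sub_nonpos]
    refine and_congr_right fun hq => forall₂_congr fun y _ => ?_
    simp only [hq, true_and]
    rw [imp_iff_not_or, not_lt]
  rw [this]
  refine hS.inter (isClosed_biInter fun y _ => IsClosed.union ?_ ?_)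
  · exact ContinuousOn.preimage_isClosed_of_isClosed (by fun_prop) hS isClosed_Ici
  · refine ContinuousOn.preimage_isClosed_of_isClosed ?_ hS isClosed_Iic
    have h1 : ContinuousOn (fun q : 𝔼 × (𝔼 →L[ℝ] 𝔼) => q.2 (y - q.1)) (frontier K ×ˢ univ) := by
      fun_prop
    fun_prop

/-- Little-o at second order through countably many scales, as needed for Borel measurability. -/
theorem isLittleO_expansion_iff {F : Set 𝔼} {x : 𝔼} (φ : 𝔼 → ℝ) :
    φ =o[𝓝[F] x] (fun y => ‖y - x‖ ^ 2) ↔ ∀ k : ℕ, ∃ j : ℕ, ∀ y ∈ F,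
      ‖y - x‖ < 1 / ((j : ℝ) + 1) → |φ y| ≤ 1 / ((k : ℝ) + 1) * ‖y - x‖ ^ 2 := by
  rw [isLittleO_iff]
  constructor
  · intro h k
    obtain ⟨η, hη, hηE⟩ := Metric.mem_nhdsWithin_iff.1
      (h (show (0 : ℝ) < 1 / ((k : ℝ) + 1) by positivity))
    obtain ⟨j, hj⟩ := exists_nat_one_div_lt hη
    refine ⟨j, fun y hy hyx => ?_⟩
    have := hηE ⟨by rw [mem_ball, dist_eq_norm]; exact hyx.trans hj, hy⟩
    simpa only [mem_ofPred_eq, Real.norm_eq_abs, abs_pow, abs_norm] using this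
  · intro h c hc
    obtain ⟨k, hk⟩ := exists_nat_one_div_lt hc
    obtain ⟨j, hj⟩ := h k
    refine Metric.mem_nhdsWithin_iff.2 ⟨1 / ((j : ℝ) + 1), by positivity, ?_⟩
    rintro y ⟨hyx, hy⟩
    rw [mem_ball, dist_eq_norm] at hyx
    simp only [mem_ofPred_eq, Real.norm_eq_abs, abs_pow, abs_norm]
    exact (hj y hy hyx).trans (by gcongr)

theorem measurableSet_isWeingartenMap {K : Set 𝔼}
    (hN : ContinuousOn (outerNormal K) (frontier K)) :
    MeasurableSet {q : 𝔼 × (𝔼 →L[ℝ] 𝔼) | q.1 ∈ frontier K ∧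
      IsWeingartenMap K q.1 (q.2 : 𝔼 →ₗ[ℝ] 𝔼)} := by
  have hS : IsClosed (frontier K ×ˢ (univ : Set (𝔼 →L[ℝ] 𝔼))) := isClosed_frontier.prod isClosed_univ
  have hN' : ContinuousOn (fun q : 𝔼 × (𝔼 →L[ℝ] 𝔼) => outerNormal K q.1) (frontier K ×ˢ univ) :=
    hN.comp continuousOn_fst fun q hq => hq.1
  have h1 : IsClosed ((frontier K ×ˢ (univ : Set (𝔼 →L[ℝ] 𝔼))) ∩
      (fun q => q.2 (outerNormal K q.1)) ⁻¹' {0}) :=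
    ContinuousOn.preimage_isClosed_of_isClosed (by fun_prop) hS isClosed_singleton
  have h2 : IsClosed {q : 𝔼 × (𝔼 →L[ℝ] 𝔼) | ∀ a b, ⟪q.2 a, b⟫ = ⟪a, q.2 b⟫} := by
    simp only [ofPred_forall]
    exact isClosed_iInter fun a => isClosed_iInter fun b => isClosed_eq (by fun_prop) (by fun_prop)
  have h3 : MeasurableSet (⋂ k : ℕ, ⋃ j : ℕ,
      expansionSet K (1 / ((k : ℝ) + 1)) (1 / ((j : ℝ) + 1))) :=
    MeasurableSet.iInter fun k => MeasurableSet.iUnion fun j =>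
      (isClosed_expansionSet hN _ _).measurableSet
  convert (h1.measurableSet.inter h2.measurableSet).inter h3 using 1
  ext ⟨x, A⟩
  simp only [mem_ofPred_eq, mem_inter_iff, mem_prod, mem_univ, and_true, mem_preimage,
    mem_singleton_iff, mem_iInter, mem_iUnion, expansionSet]
  constructor
  · rintro ⟨hx, h⟩
    refine ⟨⟨⟨hx, h.normal⟩, h.symmetric⟩, fun k => ?_⟩
    obtain ⟨j, hj⟩ := (isLittleO_expansion_iff _).1 h.expansion k
    exact ⟨j, hx, hj⟩
  · rintro ⟨⟨⟨hx, hn⟩, hs⟩, he⟩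
    refine ⟨hx, hs, hn, (isLittleO_expansion_iff _).2 fun k => ?_⟩
    obtain ⟨j, -, hj⟩ := he k
    exact ⟨j, hj⟩

/-- On the boundary the Weingarten map agrees with a Borel function; at points without one, both are
`0`. -/
theorem exists_measurable_eqOn_weingartenCLM {K : Set 𝔼} {r : ℝ}
    (hK : ∀ x ∈ frontier K, TouchesInside K r x (outerNormal K x)) :
    ∃ W : 𝔼 → (𝔼 →L[ℝ] 𝔼), Measurable W ∧ EqOn (weingartenCLM K) W (frontier K) := by
  set D : Set 𝔼 := {x ∈ frontier K | ∃ A, IsWeingartenMap K x A} with hD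
  refine ⟨D.indicator (weingartenCLM K), measurable_indicator_of_measurableSet_graph ?_, ?_⟩
  · convert measurableSet_isWeingartenMap (continuousOn_outerNormal hK) using 1
    ext ⟨x, A⟩
    simp only [hD, mem_ofPred_eq]
    constructor
    · rintro ⟨⟨hx, hex⟩, rfl⟩
      exact ⟨hx, isWeingartenMap_weingartenMap hex⟩
    · rintro ⟨hx, hA⟩
      refine ⟨⟨hx, _, hA⟩, ContinuousLinearMap.coe_injective ?_⟩
      exact (hK x hx).isWeingartenMap_unique hA (isWeingartenMap_weingartenMap ⟨_, hA⟩)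
  · intro x hx
    by_cases hex : ∃ A, IsWeingartenMap K x A
    · rw [indicator_of_mem (show x ∈ D from ⟨hx, hex⟩)]
    · rw [indicator_of_notMem (fun h : x ∈ D => hex h.2), weingartenCLM, weingartenMap,
        dif_neg hex, map_zero]

/-! ### Elementary symmetric functions of the curvatures -/

/-- The coefficients of the characteristic polynomial depend continuously on the endomorphism. -/
theorem continuous_coeff_charpoly (i : ℕ) :
    Continuous fun A : 𝔼 →L[ℝ] 𝔼 => (A : 𝔼 →ₗ[ℝ] 𝔼).charpoly.coeff i := by
  set b := (EuclideanSpace.basisFun (Fin n) ℝ).toBasis with hb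
  have h : ∀ A : 𝔼 →L[ℝ] 𝔼, (A : 𝔼 →ₗ[ℝ] 𝔼).charpoly.coeff i =
      MvPolynomial.eval (fun q : Fin n × Fin n => LinearMap.toMatrix b b (A : 𝔼 →ₗ[ℝ] 𝔼) q.1 q.2)
        ((Matrix.charpoly.univ ℝ (Fin n)).coeff i) := fun A => by
    have := Matrix.charpoly.univ_coeff_eval₂Hom (Fin n) (RingHom.id ℝ)
      (fun q : Fin n × Fin n => LinearMap.toMatrix b b (A : 𝔼 →ₗ[ℝ] 𝔼) q.1 q.2) i
    rw [← LinearMap.charpoly_toMatrix _ b]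
    exact this.symm
  simp only [h]
  refine (MvPolynomial.continuous_eval _).comp (continuous_pi fun q => ?_)
  simp only [LinearMap.toMatrix_apply, hb, OrthonormalBasis.coe_toBasis_repr_apply,
    OrthonormalBasis.coe_toBasis, EuclideanSpace.basisFun_repr, ContinuousLinearMap.coe_coe]
  fun_prop

theorem esymm_zero_cons {R : Type*} [CommSemiring R] (s : Multiset R) (j : ℕ) :
    (0 ::ₘ s).esymm j = s.esymm j := by
  cases j with
  | zero => simp [Multiset.esymm]
  | succ j => simp [Multiset.esymm, Multiset.powersetCard_cons]

/-- Vieta's formula for the eigenvalues of a symmetric map with a nontrivial kernel, after one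
eigenvalue `0` has been removed. -/
theorem esymm_roots_charpoly_erase_zero {A : 𝔼 →ₗ[ℝ] 𝔼} (hA : A.IsSymmetric) {u : 𝔼} (hu : u ≠ 0)
    (hAu : A u = 0) {j : ℕ} (hj : j ≤ n) :
    (A.charpoly.roots.erase 0).esymm j = (-1) ^ j * A.charpoly.coeff (n - j) := by
  have hdeg : A.charpoly.natDegree = n := by
    rw [LinearMap.charpoly_natDegree, finrank_euclideanSpace_fin]
  have hroot : (0 : ℝ) ∈ A.charpoly.roots := by
    rw [Polynomial.mem_roots A.charpoly_monic.ne_zero, ← Module.End.hasEigenvalue_iff_isRoot_charpoly]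
    exact Module.End.hasEigenvalue_of_hasEigenvector (x := u)
      ⟨Module.End.mem_eigenspace_iff.2 (by simpa using hAu), hu⟩
  have hv := Polynomial.coeff_eq_esymm_roots_of_splits hA.splits_charpoly (k := n - j)
    (by rw [hdeg]; omega)
  rw [hdeg, A.charpoly_monic.leadingCoeff, one_mul, Nat.sub_sub_self hj,
    ← Multiset.cons_erase hroot, esymm_zero_cons] at hv
  rw [hv, ← mul_assoc, ← mul_pow]
  simp

/-- The function `H_j` as a polynomial in the Weingarten map. -/
def curvaturePoly (j : ℕ) (A : 𝔼 →L[ℝ] 𝔼) : ℝ :=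
  ((n - 1).choose j : ℝ)⁻¹ * ((-1) ^ j * (A : 𝔼 →ₗ[ℝ] 𝔼).charpoly.coeff (n - j))

theorem continuous_curvaturePoly (j : ℕ) : Continuous (curvaturePoly (n := n) j) :=
  continuous_const.mul (continuous_const.mul (continuous_coeff_charpoly _))

theorem curvatureH_eq_curvaturePoly {K : Set 𝔼} {x u : 𝔼} (hu : u ≠ 0)
    (hW : outerNormal K x = u) {j : ℕ} (hj : j ≤ n) :
    curvatureH K j x = curvaturePoly j (weingartenCLM K x) := by
  rw [curvatureH, curvaturePoly, principalCurvatures, weingartenCLM]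
  simp only [LinearMap.coe_toContinuousLinearMap]
  by_cases hex : ∃ A, IsWeingartenMap K x A
  · have hA := isWeingartenMap_weingartenMap hex
    rw [esymm_roots_charpoly_erase_zero hA.symmetric hu (hW ▸ hA.normal) hj]
  · rw [weingartenMap, dif_neg hex,
      esymm_roots_charpoly_erase_zero LinearMap.IsSymmetric.zero hu (by simp) hj]

/-! ### Integrability -/

/-- The factor of the integrand that depends on the curvatures, as a function of the Weingarten
map. -/
def curvatureFactor (n : ℕ) (p : ℝ) (m : ℕ)
    (A : EuclideanSpace ℝ (Fin n) →L[ℝ] EuclideanSpace ℝ (Fin n)) : ℝ :=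
  curvaturePoly (n - 1) A ^ (p / (n + p)) *
    ∑ i ∈ indexSet n m, coeffC n p i *
      ∏ j : Fin (n - 1),
        (((n - 1).choose ((j : ℕ) + 1) : ℝ) ^ i j * curvaturePoly ((j : ℕ) + 1) A ^ i j)

theorem continuous_curvatureFactor {p : ℝ} (hp : 0 ≤ p / (n + p)) (m : ℕ) :
    Continuous (curvatureFactor n p m) := by
  unfold curvatureFactor
  refine ((Real.continuous_rpow_const hp).comp (continuous_curvaturePoly _)).mul ?_
  refine continuous_finsetSum _ fun i _ => continuous_const.mul ?_
  exact continuous_finsetProd _ fun j _ =>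
    continuous_const.mul ((continuous_curvaturePoly _).pow _)

theorem integrableOn_steinerIntegrand {p : ℝ} (hp : 0 ≤ p / (n + p)) (m k : ℕ)
    {K : Set 𝔼} (hK : K ∈ rollingClass n) :
    IntegrableOn (steinerIntegrand p m k K) (frontier K) μHE[n - 1] := by
  obtain ⟨r, hr, hT⟩ := exists_touchesInside_of_mem_rollingClass hK
  have hb := hK.1
  have hcomp : IsCompact (frontier K) := hb.isCompact.of_isClosed_subset isClosed_frontier
    hb.isCompact.isClosed.frontier_subset
  have hfin := measure_frontier_lt_top hb.isConvex hb.isCompact ⟨0, hb.zero_mem⟩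
  obtain ⟨W, hWm, hWeq⟩ := exists_measurable_eqOn_weingartenCLM hT
  have hN := continuousOn_outerNormal hT
  obtain ⟨ρ, hρ, hρK⟩ := Metric.mem_nhds_iff.1 (mem_interior_iff_mem_nhds.1 hb.zero_mem)
  have hρK' : closedBall (0 : 𝔼) (ρ / 2) ⊆ K :=
    (closedBall_subset_ball (by linarith)).trans hρK
  set s : 𝔼 → ℝ := fun x => ⟪x, outerNormal K x⟫ ^ ((m : ℝ) - k + n * (1 - p) / (n + p)) with hs
  have hsc : ContinuousOn s (frontier K) := by
    refine ContinuousOn.rpow_const (by fun_prop) fun x hx => Or.inl ?_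
    have := (hT x hx).normal.le_inner_of_closedBall_subset (by positivity) hρK'
    linarith
  have hg := continuous_curvatureFactor hp m
  have heq : EqOn (fun x => s x * curvatureFactor n p m (W x)) (steinerIntegrand p m k K)
      (frontier K) := fun x hx => by
    have hu : outerNormal K x ≠ 0 := fun h0 => by
      have := (hT x hx).normal.1
      rw [h0] at this
      simp at this
    simp only
    rw [← hWeq hx, steinerIntegrand, curvatureFactor, curvatureH_eq_curvaturePoly hu rfl
      (Nat.sub_le n 1), ← mul_assoc]
    congr 1
    refine Finset.sum_congr rfl fun i _ => congrArg _ (Finset.prod_congr rfl fun j _ => ?_)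
    rw [curvatureH_eq_curvaturePoly hu rfl (by omega)]
  refine IntegrableOn.congr_fun ?_ heq isClosed_frontier.measurableSet
  obtain ⟨C₁, hC₁⟩ := hcomp.exists_bound_of_continuousOn hsc
  obtain ⟨C₂, hC₂⟩ := (isCompact_closedBall (0 : 𝔼 →L[ℝ] 𝔼) (1 / r + 2)).exists_bound_of_continuousOn
    hg.continuousOn
  refine IntegrableOn.of_bound hfin ?_ (C₁ * C₂) ?_
  · exact (hsc.aestronglyMeasurable isClosed_frontier.measurableSet).mul
      (hg.measurable.comp hWm).aestronglyMeasurable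
  · refine (ae_restrict_iff' isClosed_frontier.measurableSet).2 (Eventually.of_forall fun x hx => ?_)
    rw [norm_mul]
    have h1 := hC₁ x hx
    refine mul_le_mul h1 (hC₂ _ ?_) (norm_nonneg _) ((norm_nonneg _).trans h1)
    rw [mem_closedBall, dist_zero_right, ← hWeq hx]
    exact ContinuousLinearMap.opNorm_le_bound _ (by positivity) fun w =>
      (hT x hx).norm_weingartenMap_le hb.isCompact.isClosed w

/-! ### The boundaries of the union and of the intersection -/

section UnionInter

variable {X : Type*} [TopologicalSpace X] {K L : Set X}

theorem mem_frontier_union_of_notMem (hL : IsClosed L) {x : X} (hx : x ∈ frontier K)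
    (hxL : x ∉ L) : x ∈ frontier (K ∪ L) := by
  refine ⟨closure_mono subset_union_left hx.1, fun hint => hx.2 ?_⟩
  refine mem_interior.2 ⟨interior (K ∪ L) ∩ Lᶜ, fun y hy => ?_, isOpen_interior.inter hL.isOpen_compl,
    hint, hxL⟩
  exact (interior_subset hy.1).resolve_right hy.2

theorem frontier_union_eq_of_isClosed (hK : IsClosed K) (hL : IsClosed L)
    (h : frontier K ∩ frontier L ⊆ frontier (K ∪ L)) :
    frontier (K ∪ L) = (frontier K \ L) ∪ (frontier L \ K) ∪ (frontier K ∩ frontier L) := by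
  apply Subset.antisymm
  · intro x hx
    have hxm := (hK.union hL).frontier_subset hx
    have h1 : x ∈ K → x ∈ frontier K := fun hxK =>
      ⟨subset_closure hxK, fun hi => hx.2 (interior_mono subset_union_left hi)⟩
    have h2 : x ∈ L → x ∈ frontier L := fun hxL =>
      ⟨subset_closure hxL, fun hi => hx.2 (interior_mono subset_union_right hi)⟩
    simp only [mem_union, Set.mem_sdiff, mem_inter_iff] at hxm ⊢
    tauto
  · rintro x ((⟨hx, hx'⟩ | ⟨hx, hx'⟩) | hx)
    · exact mem_frontier_union_of_notMem hL hx hx'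
    · rw [union_comm]
      exact mem_frontier_union_of_notMem hK hx hx'
    · exact h hx

theorem frontier_inter_eq_of_isClosed (hK : IsClosed K) (hL : IsClosed L) :
    frontier (K ∩ L) =
      (frontier K ∩ interior L) ∪ (frontier L ∩ interior K) ∪ (frontier K ∩ frontier L) := by
  rw [(hK.inter hL).frontier_eq, hK.frontier_eq, hL.frontier_eq, interior_inter]
  ext x
  have h1 : x ∈ interior K → x ∈ K := fun h => interior_subset h
  have h2 : x ∈ interior L → x ∈ L := fun h => interior_subset h
  simp only [mem_union, Set.mem_sdiff, mem_inter_iff]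
  tauto

theorem frontier_eq_union_of_isClosed (K : Set X) (hL : IsClosed L) :
    frontier K = (frontier K \ L) ∪ (frontier K ∩ interior L) ∪ (frontier K ∩ frontier L) := by
  rw [hL.frontier_eq]
  ext x
  have h2 : x ∈ interior L → x ∈ L := fun h => interior_subset h
  simp only [mem_union, Set.mem_sdiff, mem_inter_iff]
  tauto

end UnionInter

theorem setIntegral_union₃ {X : Type*} [MeasurableSpace X] {μ : Measure X} {S A B C : Set X}
    {f : X → ℝ} (hS : S = A ∪ B ∪ C) (hB : MeasurableSet B) (hC : MeasurableSet C)
    (hAB : Disjoint A B) (hAC : Disjoint A C) (hBC : Disjoint B C) (hf : IntegrableOn f S μ) :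
    ∫ x in S, f x ∂μ = ∫ x in A, f x ∂μ + ∫ x in B, f x ∂μ + ∫ x in C, f x ∂μ := by
  subst hS
  have h1 := hf.mono_set (subset_union_left : A ∪ B ⊆ _)
  rw [setIntegral_union (hAC.union_left hBC) hC h1 (hf.mono_set subset_union_right),
    setIntegral_union hAB hB (h1.mono_set subset_union_left) (h1.mono_set subset_union_right)]

/-- A common boundary point of `K` and `L` is not interior to the union: both supporting
half-spaces exclude the points `(1 + t) x`. -/
theorem frontier_inter_frontier_subset_frontier_union {K L : Set 𝔼} (hK : IsConvexBodyO K)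
    (hL : IsConvexBodyO L) : frontier K ∩ frontier L ⊆ frontier (K ∪ L) := by
  -- Outer normals `u` at `x` satisfy `⟪x, u⟫ > 0`, since `0` is an interior point.
  have key : ∀ {M : Set 𝔼}, IsConvexBodyO M → ∀ {x : 𝔼}, x ∈ frontier M → ∀ t : ℝ, 0 < t →
      x + t • x ∉ M := fun {M} hM {x} hx t ht hmem => by
    obtain ⟨u, hu⟩ := exists_isOuterNormal hM.isConvex ⟨0, hM.zero_mem⟩ hx
    obtain ⟨ρ, hρ, hρM⟩ := Metric.mem_nhds_iff.1 (mem_interior_iff_mem_nhds.1 hM.zero_mem)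
    have h1 := hu.le_inner_of_closedBall_subset (half_pos hρ).le
      ((closedBall_subset_ball (by linarith)).trans hρM)
    have h2 := hu.2 _ hmem
    rw [add_sub_cancel_left, inner_smul_left] at h2
    have h3 : 0 < t * ⟪x, u⟫ := mul_pos ht (by linarith)
    exact absurd h2 (not_le.2 h3)
  rintro x ⟨hxK, hxL⟩
  refine ⟨closure_mono subset_union_left hxK.1, fun hint => ?_⟩
  have hlim : Tendsto (fun t : ℝ => x + t • x) (𝓝[>] 0) (𝓝 (x + (0 : ℝ) • x)) := by
    apply Tendsto.mono_left _ nhdsWithin_le_nhds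
    exact Continuous.tendsto (by fun_prop) 0
  rw [zero_smul, add_zero] at hlim
  obtain ⟨t, ht, ht0⟩ :=
    ((hlim.eventually (mem_interior_iff_mem_nhds.1 hint)).and self_mem_nhdsWithin).exists
  exact ht.elim (key hK hxK t ht0) (key hL hxL t ht0)

/-- At common boundary points, the four bodies `K`, `L`, `K ∪ L`, `K ∩ L` share the outer normal
and an inner touching ball. -/
theorem exists_touchesInside_common {K L : Set 𝔼} (hK : K ∈ rollingClass n)
    (hL : L ∈ rollingClass n) (hKL : IsConvexBodyO (K ∪ L)) :
    ∃ r : ℝ, ∀ z ∈ frontier K ∩ frontier L,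
      TouchesInside K r z (outerNormal K z) ∧ TouchesInside L r z (outerNormal K z) ∧
      TouchesInside (K ∪ L) r z (outerNormal K z) ∧ TouchesInside (K ∩ L) r z (outerNormal K z) := by
  obtain ⟨r₁, hr₁, hK₁⟩ := exists_touchesInside_of_mem_rollingClass hK
  obtain ⟨r₂, hr₂, hL₂⟩ := exists_touchesInside_of_mem_rollingClass hL
  refine ⟨min r₁ r₂, fun z hz => ?_⟩
  have hr : 0 < min r₁ r₂ := lt_min hr₁ hr₂
  obtain ⟨w, hw⟩ := exists_isOuterNormal hKL.isConvex ⟨0, hKL.zero_mem⟩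
    (frontier_inter_frontier_subset_frontier_union hK.1 hL.1 hz)
  have hwK : w = outerNormal K z := (hK₁ z hz.1).eq_of_isOuterNormal (hw.mono subset_union_left)
  have hwL : w = outerNormal L z := (hL₂ z hz.2).eq_of_isOuterNormal (hw.mono subset_union_right)
  have h1 := (hK₁ z hz.1).mono_radius hr (min_le_left _ _)
  have h2 := (hL₂ z hz.2).mono_radius hr (min_le_right _ _)
  rw [← hwL] at h2
  rw [← hwK] at h1 ⊢
  exact ⟨h1, h2, ⟨hr, hw, h1.ball.trans subset_union_left⟩,
    ⟨hr, h1.normal.mono inter_subset_left, subset_inter h1.ball h2.ball⟩⟩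

theorem IsConvexBodyO.inter {K L : Set 𝔼} (hK : IsConvexBodyO K) (hL : IsConvexBodyO L) :
    IsConvexBodyO (K ∩ L) :=
  ⟨hK.isConvex.inter hL.isConvex, hK.isCompact.inter hL.isCompact,
    by rw [interior_inter]; exact ⟨hK.zero_mem, hL.zero_mem⟩⟩

/-- Almost everywhere on the common part of the boundaries, the curvature data of `K`, `L`, `K ∪ L`
and `K ∩ L` coincide, because they are determined by the common part. -/
theorem ae_steinerIntegrand_eq {K L : Set 𝔼} (p : ℝ) (m k : ℕ) (hK : K ∈ rollingClass n)
    (hL : L ∈ rollingClass n) (hKL : IsConvexBodyO (K ∪ L)) :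
    ∀ᵐ x ∂(μHE[n - 1] : Measure 𝔼).restrict (frontier K ∩ frontier L),
      steinerIntegrand p m k L x = steinerIntegrand p m k K x ∧
      steinerIntegrand p m k (K ∪ L) x = steinerIntegrand p m k K x ∧
      steinerIntegrand p m k (K ∩ L) x = steinerIntegrand p m k K x := by
  obtain ⟨r, hr⟩ := exists_touchesInside_common hK hL hKL
  set E := frontier K ∩ frontier L with hE
  have hEm : MeasurableSet E := (isClosed_frontier.inter isClosed_frontier).measurableSet
  have hae : ∀ {M : Set 𝔼}, IsConvexBodyO M →
      (∀ z ∈ E, TouchesInside M r z (outerNormal K z)) →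
      ∀ᵐ x ∂(μHE[n - 1] : Measure 𝔼).restrict E, IsNonporousAt E (frontier M) x := fun hM h =>
    ae_isNonporousAt hM.isConvex hM.isCompact.isClosed ⟨0, hM.zero_mem⟩ hEm h
  have hKt := fun z hz => (hr z hz).1
  have hLt := fun z hz => (hr z hz).2.1
  have hUt := fun z hz => (hr z hz).2.2.1
  have hIt := fun z hz => (hr z hz).2.2.2
  filter_upwards [hae hK.1 hKt, hae hL.1 hLt, hae hKL hUt, hae (hK.1.inter hL.1) hIt,
    ae_restrict_mem hEm] with x pK pL pU pI hx
  have heq : ∀ {M : Set 𝔼}, IsConvexBodyO M →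
      (∀ z ∈ E, TouchesInside M r z (outerNormal K z)) → IsNonporousAt E (frontier M) x →
      steinerIntegrand p m k M x = steinerIntegrand p m k K x := fun hM h hp =>
    steinerIntegrand_congr p m k (h x hx).outerNormal_eq (weingartenMap_congr fun A =>
      (isWeingartenMap_iff_of_isNonporousAt hM.isCompact.isClosed h hx hp A).trans
        (isWeingartenMap_iff_of_isNonporousAt hK.1.isCompact.isClosed hKt hx pK A).symm)
  exact ⟨heq hL.1 hLt pL, heq hKL hUt pU, heq (hK.1.inter hL.1) hIt pI⟩

theorem eqOn_steinerIntegrand_union {K L : Set 𝔼} (p : ℝ) (m k : ℕ) (hK : IsConvexBodyO K)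
    (hL : IsClosed L) (hKL : Convex ℝ (K ∪ L)) :
    EqOn (steinerIntegrand p m k (K ∪ L)) (steinerIntegrand p m k K) (frontier K \ L) :=
  fun _ hx => (steinerIntegrand_eq_of_inter_eq p m k hK.isConvex hKL
    (hK.isCompact.isClosed.frontier_subset hx.1) hL.isOpen_compl hx.2
    (by rw [union_inter_distrib_right, inter_compl_self, union_empty])).symm

theorem eqOn_steinerIntegrand_inter {K L : Set 𝔼} (p : ℝ) (m k : ℕ) (hK : IsConvexBodyO K)
    (hL : Convex ℝ L) :
    EqOn (steinerIntegrand p m k (K ∩ L)) (steinerIntegrand p m k K)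
      (frontier K ∩ interior L) :=
  fun _ hx => (steinerIntegrand_eq_of_inter_eq p m k hK.isConvex (hK.isConvex.inter hL)
    (hK.isCompact.isClosed.frontier_subset hx.1) isOpen_interior hx.2
    (by rw [inter_assoc, inter_eq_self_of_subset_right interior_subset])).symm

theorem integrableOn_steinerIntegrand_inter {p : ℝ} (hp : 0 ≤ p / (n + p)) (m k : ℕ)
    {K L : Set 𝔼} (hK : K ∈ rollingClass n) (hL : L ∈ rollingClass n)
    (hKL : IsConvexBodyO (K ∪ L)) :
    IntegrableOn (steinerIntegrand p m k (K ∩ L)) (frontier (K ∩ L)) μHE[n - 1] := by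
  have hfK := integrableOn_steinerIntegrand hp m k hK
  have hfL := integrableOn_steinerIntegrand hp m k hL
  have hmK : MeasurableSet (frontier K) := isClosed_frontier.measurableSet
  have hmL : MeasurableSet (frontier L) := isClosed_frontier.measurableSet
  rw [frontier_inter_eq_of_isClosed hK.1.isCompact.isClosed hL.1.isCompact.isClosed]
  refine IntegrableOn.union (IntegrableOn.union ?_ ?_) ?_
  · exact (hfK.mono_set inter_subset_left).congr_fun
      (eqOn_steinerIntegrand_inter p m k hK.1 hL.1.isConvex).symm (hmK.inter measurableSet_interior)
  · rw [inter_comm K L]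
    exact (hfL.mono_set inter_subset_left).congr_fun
      (eqOn_steinerIntegrand_inter p m k hL.1 hK.1.isConvex).symm (hmL.inter measurableSet_interior)
  · refine IntegrableOn.congr_fun_ae (hfK.mono_set inter_subset_left) ?_
    filter_upwards [ae_steinerIntegrand_eq p m k hK hL hKL] with x hx using hx.2.2.symm

/-- The Steiner coefficients are valuations: the boundaries of `K ∪ L` and `K ∩ L` are assembled
from the same pieces as those of `K` and `L`. -/
theorem isValuationOn_steinerW {p : ℝ} (hp : 0 ≤ p / (n + p)) (m k : ℕ) :
    IsValuationOn (rollingClass n) (steinerW p m k) := by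
  intro K hK L hL hKL
  have hcK := hK.1.isCompact.isClosed
  have hcL := hL.1.isCompact.isClosed
  have hmK : MeasurableSet (frontier K) := isClosed_frontier.measurableSet
  have hmL : MeasurableSet (frontier L) := isClosed_frontier.measurableSet
  have hmE := hmK.inter hmL
  have hmK1 := hmK.diff hcL.measurableSet
  have hmL1 := hmL.diff hcK.measurableSet
  have hmK2 : MeasurableSet (frontier K ∩ interior L) := hmK.inter measurableSet_interior
  have hmL2 : MeasurableSet (frontier L ∩ interior K) := hmL.inter measurableSet_interior
  have hE := ae_steinerIntegrand_eq p m k hK hL hKL.1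
  have sK := hcK.frontier_subset
  have sL := hcL.frontier_subset
  have eK := frontier_eq_union_of_isClosed K hcL
  have eL := frontier_eq_union_of_isClosed L hcK
  rw [inter_comm (frontier L) (frontier K)] at eL
  have dout : Disjoint (frontier K \ L) (frontier L \ K) :=
    disjoint_left.2 fun x h h' => h.2 (sL h'.1)
  have din : Disjoint (frontier K ∩ interior L) (frontier L ∩ interior K) :=
    disjoint_left.2 fun x h h' => h.1.2 h'.2
  have dK1 : Disjoint (frontier K \ L) (frontier K ∩ frontier L) :=
    disjoint_left.2 fun x h h' => h.2 (sL h'.2)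
  have dL1 : Disjoint (frontier L \ K) (frontier K ∩ frontier L) :=
    disjoint_left.2 fun x h h' => h.2 (sK h'.1)
  have dK2 : Disjoint (frontier K ∩ interior L) (frontier K ∩ frontier L) :=
    disjoint_left.2 fun x h h' => h'.2.2 h.2
  have dL2 : Disjoint (frontier L ∩ interior K) (frontier K ∩ frontier L) :=
    disjoint_left.2 fun x h h' => h'.1.2 h.2
  have dK12 : Disjoint (frontier K \ L) (frontier K ∩ interior L) :=
    disjoint_left.2 fun x h h' => h.2 (interior_subset h'.2)
  have dL12 : Disjoint (frontier L \ K) (frontier L ∩ interior K) :=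
    disjoint_left.2 fun x h h' => h.2 (interior_subset h'.2)
  unfold steinerW
  rw [setIntegral_union₃ (frontier_union_eq_of_isClosed hcK hcL
      (frontier_inter_frontier_subset_frontier_union hK.1 hL.1)) hmL1 hmE dout dK1 dL1
      (integrableOn_steinerIntegrand hp m k hKL),
    setIntegral_union₃ (frontier_inter_eq_of_isClosed hcK hcL) hmL2 hmE din dK2 dL2
      (integrableOn_steinerIntegrand_inter hp m k hK hL hKL.1),
    setIntegral_union₃ eK hmK2 hmE dK12 dK1 dK2 (integrableOn_steinerIntegrand hp m k hK),
    setIntegral_union₃ eL hmL2 hmE dL12 dL1 dL2 (integrableOn_steinerIntegrand hp m k hL),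
    setIntegral_congr_fun hmK1 (eqOn_steinerIntegrand_union p m k hK.1 hcL hKL.1.isConvex),
    setIntegral_congr_fun hmK2 (eqOn_steinerIntegrand_inter p m k hK.1 hL.1.isConvex),
    integral_congr_ae (hE.mono fun x hx => hx.1),
    integral_congr_ae (hE.mono fun x hx => hx.2.1),
    integral_congr_ae (hE.mono fun x hx => hx.2.2)]
  have h1 : ∫ x in frontier L \ K, steinerIntegrand p m k (K ∪ L) x ∂μHE[n - 1]
      = ∫ x in frontier L \ K, steinerIntegrand p m k L x ∂μHE[n - 1] := by
    rw [union_comm]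
    exact setIntegral_congr_fun hmL1
      (eqOn_steinerIntegrand_union p m k hL.1 hcK (union_comm K L ▸ hKL.1.isConvex))
  have h2 : ∫ x in frontier L ∩ interior K, steinerIntegrand p m k (K ∩ L) x ∂μHE[n - 1]
      = ∫ x in frontier L ∩ interior K, steinerIntegrand p m k L x ∂μHE[n - 1] := by
    rw [inter_comm K L]
    exact setIntegral_congr_fun hmL2 (eqOn_steinerIntegrand_inter p m k hL.1 hK.1.isConvex)
  rw [h1, h2]
  ring

theorem isValuationOn_steinerV {p : ℝ} (hp : 0 ≤ p / (n + p)) (k : ℕ) :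
    IsValuationOn (rollingClass n) (steinerV p k) := by
  intro K hK L hL hKL
  simp only [steinerV, ← Finset.sum_add_distrib, ← mul_add]
  exact Finset.sum_congr rfl fun m _ => by rw [isValuationOn_steinerW hp m k K hK L hL hKL]

end LpSteiner

end

theorem mainTheorem1 (n : ℕ) (hn : 1 ≤ n) (p : ℝ) (hp : 0 ≤ p ∨ p < -(n : ℝ)) (m k : ℕ) :
    (∀ K ∈ LpSteiner.rollingClass n,
      IntegrableOn (LpSteiner.steinerIntegrand p m k K) (frontier K) μHE[n - 1]) ∧
    (∀ K ∈ LpSteiner.rollingClass n, ∀ L ∈ LpSteiner.rollingClass n,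
      K ∪ L ∈ LpSteiner.rollingClass n →
      IntegrableOn (LpSteiner.steinerIntegrand p m k (K ∩ L)) (frontier (K ∩ L)) μHE[n - 1]) ∧
    LpSteiner.IsValuationOn (LpSteiner.rollingClass n) (LpSteiner.steinerW p m k) ∧
    LpSteiner.IsValuationOn (LpSteiner.rollingClass n) (LpSteiner.steinerV p k) := by
  have hp' : 0 ≤ p / (n + p) := by
    have hn0 : (0 : ℝ) ≤ n := Nat.cast_nonneg n
    rcases hp with hp | hp
    · positivity
    · exact div_nonneg_of_nonpos (by linarith) (by linarith)
  exact ⟨fun K hK => LpSteiner.integrableOn_steinerIntegrand hp' m k hK,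
    fun K hK L hL hKL => LpSteiner.integrableOn_steinerIntegrand_inter hp' m k hK hL hKL.1,
    LpSteiner.isValuationOn_steinerW hp' m k, LpSteiner.isValuationOn_steinerV hp' k⟩
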